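/- Let $\alpha,\mu,\phi_E,S_E,\hat h_{f,E},\rho_m>0$, let $h_{E,l}\neq 0$ be a deterministic path gain, and let $h_{E,pf,m}$ be a complex random variable whose modulus has the ($\alpha$-$\mu$ fading plus misalignment) probability density $$f(x)=\frac{\phi_E\,\mu^{\phi_E/\alpha}x^{\phi_E-1}}{S_E^{\phi_E}\hat h_{f,E}^{\phi_E}\Gamma(\mu)}\,\Gamma\!\left(\frac{\alpha\mu-\phi_E}{\alpha},\frac{\mu x^\alpha}{S_E^\alpha\hat h_{f,E}^\alpha}\right),\qquad x>0,$$ where $\Gamma(a,x)=\int_x^\infty t^{a-1}e^{-t}\,dt$. Put $Z_m=\log_2\!\left(1+\rho_m|h_{E,l}|^2|h_{E,pf,m}|^2\right)$ and $$\mathcal C=\mu\,(S_E\hat h_{f,E})^{-\alpha},\qquad \xi=\frac{\phi_E\,\mu^{\phi_E/\alpha}}{S_E^{\phi_E}\hat h_{f,E}^{\phi_E}\Gamma(\mu)},\qquad K=\mu-\frac{\phi_E}{\alpha}.$$ Then for every real $s$ the moment generating function $\mathbb E[e^{sZ_m}]$ is finite, and if $s/\ln 2\notin\{0,1,2,\dots\}$,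 then the Fox H function below exists and $$\mathbb E[e^{sZ_m}]=\frac{\xi\,\rho_m^{-\phi_E/2}|h_{E,l}|^{-\phi_E}}{2\,\Gamma(-s/\ln 2)}\;H^{3,1}_{2,3}\!\left[\frac{\mathcal C}{\rho_m^{\alpha/2}|h_{E,l}|^{\alpha}}\;\middle|\;\begin{matrix}(1-\frac{\phi_E}{2},\frac{\alpha}{2}),\ (1,1)\\ (0,1),\ (K,1),\ (-\frac{\phi_E}{2}-\frac{s}{\ln 2},\frac{\alpha}{2})\end{matrix}\right].$$ If $s/\ln 2\in\{0,1,2,\dots\}$ (where the Fox H function is undefined, because poles that its contour has to separate coincide), then $\mathbb E[e^{sZ_m}]$ is the limit of the right-hand side as $s'\to s$, $s'\ne s$ (with $s'$ in place of $s$). Here $H^{m,n}_{p,q}\!\left[z\,\middle|\begin{smallmatrix}(a_i,A_i)\\(b_j,B_j)\end{smallmatrix}\right]=\frac1{2\pi \mathrm i}\int_{L}\frac{\prod_{j\le m}\Gamma(b_j+B_ju)\prod_{i\le n}\Gamma(1-a_i-A_iu)}{\prod_{i>n}\Gamma(a_i+A_iu)\prod_{j>m}\Gamma(1-b_j-B_ju)}\,z^{-u}\,du$,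 where $L$ is a contour that runs upwards along a vertical line, indented where necessary so that it has the poles of the $\Gamma(b_j+B_ju)$, $j\le m$, on its left and those of the $\Gamma(1-a_i-A_iu)$, $i\le n$, on its right. -/

import Mathlib

/-! ### The Fox H function

`H^{m,n}_{p,q}[z | (a_i, A_i) ; (b_j, B_j)] = (1 / 2πi) ∫_L Θ(u) z^{-u} du`, with the Mellin kernel
`Θ(u) = ∏_{j ≤ m} Γ(b_j + B_j u) ∏_{i ≤ n} Γ(1 - a_i - A_i u)
  / (∏_{i > n} Γ(a_i + A_i u) ∏_{j > m} Γ(1 - b_j - B_j u))`,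
where the upward contour `L` has the poles of the `Γ(b_j + B_j u)`, `j ≤ m`, on its left and the
poles of the `Γ(1 - a_i - A_i u)`, `i ≤ n`, on its right. -/

namespace FoxH

noncomputable section

/-- The Mellin kernel `Θ(u)`. (`Complex.Gamma` is `0` at its poles, so that `(Gamma w)⁻¹` is the
entire function `1/Γ`.) -/
def kernel {p q : ℕ} (m n : ℕ) (a : Fin p → ℂ) (A : Fin p → ℝ) (b : Fin q → ℂ) (B : Fin q → ℝ)
    (u : ℂ) : ℂ :=
  (∏ j : Fin q, if (j : ℕ) < m then Complex.Gamma (b j + B j * u)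
      else (Complex.Gamma (1 - b j - B j * u))⁻¹) *
    ∏ i : Fin p, if (i : ℕ) < n then Complex.Gamma (1 - a i - A i * u)
      else (Complex.Gamma (a i + A i * u))⁻¹

/-- The integrand `Θ(u) z^{-u}`. -/
def integrand {p q : ℕ} (m n : ℕ) (a : Fin p → ℂ) (A : Fin p → ℝ) (b : Fin q → ℂ)
    (B : Fin q → ℝ) (z u : ℂ) : ℂ :=
  kernel m n a A b B u * z ^ (-u)

/-- The poles of the factors `Γ(b_j + B_j u)`, `j ≤ m`. -/
def leftPoles {q : ℕ} (m : ℕ) (b : Fin q → ℂ) (B : Fin q → ℝ) : Set ℂ :=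
  {w | ∃ (j : Fin q) (k : ℕ), (j : ℕ) < m ∧ b j + B j * w = -(k : ℂ)}

/-- The poles of the factors `Γ(1 - a_i - A_i u)`, `i ≤ n`. -/
def rightPoles {p : ℕ} (n : ℕ) (a : Fin p → ℂ) (A : Fin p → ℝ) : Set ℂ :=
  {w | ∃ (i : Fin p) (k : ℕ), (i : ℕ) < n ∧ 1 - a i - A i * w = -(k : ℂ)}

/-- The pair `(γ, ε)` describes a contour separating `PL` from `PR`: the upward line `Re u = γ`
meets no pole, and the discs of radius `ε` around the poles lying on the wrong side of the line
(points of `PL` to its right, points of `PR` to its left) contain no other pole. The contour is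
the line, indented so as to pass each of these poles on the required side. -/
def IsSeparating (PL PR : Set ℂ) (γ ε : ℝ) : Prop :=
  Disjoint PL PR ∧ 0 < ε ∧ (∀ w ∈ PL ∪ PR, w.re ≠ γ) ∧
    ∀ w ∈ {w ∈ PL | γ < w.re} ∪ {w ∈ PR | w.re < γ},
      ∀ w' ∈ PL ∪ PR, w' ≠ w → ε < dist w' w

/-- `(1 / 2πi) ∫_L f(u) du` along the separating contour given by `(γ, ε)`. Pulling the line over
to the right of a point of `PL` adds a counterclockwise loop around it, and pulling it over to the
left of a point of `PR` adds a clockwise loop. If no pole is on the wrong side of the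
line, this is just `(1 / 2πi) ∫_{γ - i∞}^{γ + i∞} f(u) du`. -/
def contourIntegral (PL PR : Set ℂ) (γ ε : ℝ) (f : ℂ → ℂ) : ℂ :=
  (2 * Real.pi * Complex.I)⁻¹ *
    ((∫ t : ℝ, f (γ + t * Complex.I) * Complex.I)
      + (∑ᶠ w ∈ {w ∈ PL | γ < w.re}, circleIntegral f w ε)
      - ∑ᶠ w ∈ {w ∈ PR | w.re < γ}, circleIntegral f w ε)

/-- `v` is the value of the Mellin-Barnes integral defining `H^{m,n}_{p,q}` at `z`, taken along
some separating contour on which the integral converges absolutely. -/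
def IsValue {p q : ℕ} (m n : ℕ) (a : Fin p → ℂ) (A : Fin p → ℝ) (b : Fin q → ℂ) (B : Fin q → ℝ)
    (z v : ℂ) : Prop :=
  (∀ i, 0 < A i) ∧ (∀ j, 0 < B j) ∧ z ≠ 0 ∧
    ∃ γ ε : ℝ, IsSeparating (leftPoles m b B) (rightPoles n a A) γ ε ∧
      MeasureTheory.Integrable (fun t : ℝ => integrand m n a A b B z (γ + t * Complex.I)) ∧
      v = contourIntegral (leftPoles m b B) (rightPoles n a A) γ ε (integrand m n a A b B z)

open Classical in
/-- The Fox H function `H^{m,n}_{p,q}[z | (a_i, A_i) ; (b_j, B_j)]` (`0` if it does not exist). -/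
def foxH {p q : ℕ} (m n : ℕ) (a : Fin p → ℂ) (A : Fin p → ℝ) (b : Fin q → ℂ) (B : Fin q → ℝ)
    (z : ℂ) : ℂ :=
  if h : ∃ v, IsValue m n a A b B z v then h.choose else 0

end

end FoxH

/-! ### The THz fading channel -/

namespace THz

noncomputable section

/-- The upper incomplete Gamma function `Γ(a, x) = ∫_x^∞ t^{a-1} e^{-t} dt`, for `x > 0`. -/
def upperGamma (a x : ℝ) : ℝ :=
  ∫ t in Set.Ioi x, t ^ (a - 1) * Real.exp (-t)

/-- The density on `(0, ∞)` of the envelope `|h_pf|` under α-μ fading and antenna misalignment. -/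
def envelopePDF (α μ φ S hf x : ℝ) : ℝ :=
  φ * μ ^ (φ / α) * x ^ (φ - 1) / (S ^ φ * hf ^ φ * Real.Gamma μ) *
    upperGamma ((α * μ - φ) / α) (μ * x ^ α / (S ^ α * hf ^ α))

/-- The mutual information of one round, `Z = log₂ (1 + ρ |h_l|² |h_pf|²)`. -/
def mutualInfo {Ω : Type*} (ρ : ℝ) (hl : ℂ) (hpf : Ω → ℂ) (ω : Ω) : ℝ :=
  Real.logb 2 (1 + ρ * ‖hl‖ ^ 2 * ‖hpf ω‖ ^ 2)

/-- `C = μ (S ĥ_f)^{-α}`. -/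
def constC (α μ S hf : ℝ) : ℝ := μ * (S * hf) ^ (-α)

/-- `ξ = φ μ^{φ/α} S^{-φ} ĥ_f^{-φ} Γ(μ)⁻¹`. -/
def constXi (α μ φ S hf : ℝ) : ℝ :=
  φ * μ ^ (φ / α) * S ^ (-φ) * hf ^ (-φ) * (Real.Gamma μ)⁻¹

/-- `K = μ - φ / α`. -/
def constK (α μ φ : ℝ) : ℝ := μ - α⁻¹ * φ

/-- First components of the upper parameters `(1 - φ/2, α/2), (1, 1)`. -/
def upperShift (φ : ℝ) : Fin 2 → ℂ := ![((1 - φ / 2 : ℝ) : ℂ), 1]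

/-- Second components of the upper parameters `(1 - φ/2, α/2), (1, 1)`. -/
def upperScale (α : ℝ) : Fin 2 → ℝ := ![α / 2, 1]

/-- First components of the lower parameters `(0, 1), (K, 1), (-φ/2 - s/ln 2, α/2)`. -/
def lowerShift (α μ φ s : ℝ) : Fin 3 → ℂ :=
  ![0, (constK α μ φ : ℂ), ((-(φ / 2) - s / Real.log 2 : ℝ) : ℂ)]

/-- Second components of the lower parameters `(0, 1), (K, 1), (-φ/2 - s/ln 2, α/2)`. -/
def lowerScale (α : ℝ) : Fin 3 → ℝ := ![1, 1, α / 2]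

/-- The argument `C / (ρ^{α/2} |h_l|^α)`. -/
def foxArg (α μ S hf ρ : ℝ) (hl : ℂ) : ℂ :=
  ((constC α μ S hf / (ρ ^ (α / 2) * ‖hl‖ ^ α) : ℝ) : ℂ)

/-- The closed form of the moment generating function of `Z`,
`ξ ρ^{-φ/2} |h_l|^{-φ} / (2 Γ(-s/ln 2)) * H^{3,1}_{2,3}[C / (ρ^{α/2} |h_l|^α) | …]`. -/
def closedForm (α μ φ S hf ρ : ℝ) (hl : ℂ) (s : ℝ) : ℂ :=
  ((constXi α μ φ S hf * ρ ^ (-φ / 2) * ‖hl‖ ^ (-φ) / (2 * Real.Gamma (-(s / Real.log 2))) : ℝ) : ℂ)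
    * FoxH.foxH 3 1 (upperShift φ) (upperScale α) (lowerShift α μ φ s) (lowerScale α)
        (foxArg α μ S hf ρ hl)

end

end THz

/-! Put σ = s / ln 2 and c = ρ‖hl‖². Since exp(sZ) = (1 + c|h|²)^σ, the moment generating function
is, up to ξ, the integral `powerMoment` of (1 + cx²)^σ x^(φ-1) Γ(K, Cx^α) over x > 0. It has to be
matched with a Mellin-Barnes integral whose contour may need indentations.

For σ < 0 no indentation is needed. Write (1 + y)^σ as a Mellin-Barnes integral of a product of two
Gamma functions, interchange it with the x-integral (Fubini), and insert the Mellin transform of the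
incomplete Gamma function. After a linear change of variable this is the Fox H integrand on a
straight line that already separates the poles (`exists_contourIntegral_of_neg`).

For σ > 0, σ not a natural number, both sides satisfy one recursion. On the moment side it is (1 +
y)^σ = (1 + y)^(σ-1) + y(1 + y)^(σ-1), which lowers σ and replaces φ by φ or φ + 2
(`powerMoment_eq_add`). On the contour side it is the functional equation of Γ applied to the two
factors containing α/2 (`neg_mul_mgfIntegrand`). Only φ moves while K stays fixed, so K and φ are
decoupled; K + φ/α > 0, which for the actual K says μ > 0, survives the shift. Induction on a
natural number exceeding σ reduces to σ < 0 (`contourIntegral_mgfIntegrand`).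

The recursion compares integrands with different poles, so the value must be independent of the
separating contour and of superfluous points in the pole sets (`IsMellinBarnes.contourIntegral_eq`).
This is a residue argument: moving the line across a pole changes the line integral by exactly the
loop that the contour definition adds or removes. At the exceptional s the claim follows from
continuity of the moment generating function. -/

noncomputable section

open Complex Set Filter MeasureTheory Topology
open scoped Interval

/-! ### Residues through rectangles around a real pole -/

namespace FoxH

/-- The integral of `f` over the boundary of `[a, b] × [-T, T]`, counterclockwise. -/
def rectIntegral (f : ℂ → ℂ) (a b T : ℝ) : ℂ :=
  (∫ x : ℝ in a..b, f (x + (-T : ℝ) * I)) - (∫ x : ℝ in a..b, f (x + T * I)) +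
    I * (∫ y : ℝ in (-T)..T, f (b + y * I)) - I * ∫ y : ℝ in (-T)..T, f (a + y * I)

lemma rectIntegral_eq_zero {f : ℂ → ℂ} {a b T : ℝ}
    (hf : DifferentiableOn ℂ f ([[a, b]] ×ℂ [[-T, T]])) : rectIntegral f a b T = 0 := by
  have h := integral_boundary_rect_eq_zero_of_differentiableOn f
    (a + (-T : ℝ) * I) (b + T * I) (by simpa using hf)
  simpa [rectIntegral] using h

lemma rect_sides_mem {a b T p : ℝ} (ha : a < p) (hb : p < b) (hT : 0 < T) :
    (∀ x ∈ [[a, b]], (x + (-T : ℝ) * I : ℂ) ∈ ([[a, b]] ×ℂ [[-T, T]]) \ {(p : ℂ)}) ∧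
    (∀ x ∈ [[a, b]], (x + T * I : ℂ) ∈ ([[a, b]] ×ℂ [[-T, T]]) \ {(p : ℂ)}) ∧
    (∀ y ∈ [[-T, T]], (b + y * I : ℂ) ∈ ([[a, b]] ×ℂ [[-T, T]]) \ {(p : ℂ)}) ∧
    (∀ y ∈ [[-T, T]], (a + y * I : ℂ) ∈ ([[a, b]] ×ℂ [[-T, T]]) \ {(p : ℂ)}) := by
  refine ⟨fun x hx => ⟨?_, fun h => ?_⟩, fun x hx => ⟨?_, fun h => ?_⟩,
    fun x hx => ⟨?_, fun h => ?_⟩, fun x hx => ⟨?_, fun h => ?_⟩⟩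
  · rw [mem_reProdIm]; exact ⟨by simpa using hx, by simp⟩
  · have := congrArg Complex.im h; simp at this; exact hT.ne' this
  · rw [mem_reProdIm]; exact ⟨by simpa using hx, by simp⟩
  · have := congrArg Complex.im h; simp at this; exact hT.ne' this
  · rw [mem_reProdIm]; exact ⟨by simp, by simpa using hx⟩
  · have := congrArg Complex.re h; simp at this; exact hb.ne' this
  · rw [mem_reProdIm]; exact ⟨by simp, by simpa using hx⟩
  · have := congrArg Complex.re h; simp at this; exact ha.ne this

lemma rectIntegral_add {f g : ℂ → ℂ} {a b T p : ℝ} (ha : a < p) (hb : p < b) (hT : 0 < T)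
    (hf : ContinuousOn f (([[a, b]] ×ℂ [[-T, T]]) \ {(p : ℂ)}))
    (hg : ContinuousOn g (([[a, b]] ×ℂ [[-T, T]]) \ {(p : ℂ)})) :
    rectIntegral (fun u => f u + g u) a b T = rectIntegral f a b T + rectIntegral g a b T := by
  obtain ⟨h1, h2, h3, h4⟩ := rect_sides_mem ha hb hT
  have key : ∀ (F : ℂ → ℂ) (_ : ContinuousOn F (([[a, b]] ×ℂ [[-T, T]]) \ {(p : ℂ)}))
      (γ : ℝ → ℂ) (_ : Continuous γ) (l r : ℝ)
      (_ : ∀ x ∈ [[l, r]], γ x ∈ ([[a, b]] ×ℂ [[-T, T]]) \ {(p : ℂ)}),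
      IntervalIntegrable (fun x => F (γ x)) volume l r := fun F hF γ hγ l r hm =>
    (hF.comp hγ.continuousOn hm).intervalIntegrable
  unfold rectIntegral
  rw [intervalIntegral.integral_add (key f hf _ (by fun_prop) _ _ h1)
      (key g hg _ (by fun_prop) _ _ h1),
    intervalIntegral.integral_add (key f hf _ (by fun_prop) _ _ h2)
      (key g hg _ (by fun_prop) _ _ h2),
    intervalIntegral.integral_add (key f hf _ (by fun_prop) _ _ h3)
      (key g hg _ (by fun_prop) _ _ h3),
    intervalIntegral.integral_add (key f hf _ (by fun_prop) _ _ h4)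
      (key g hg _ (by fun_prop) _ _ h4)]
  ring

lemma rectIntegral_const_mul (c : ℂ) (f : ℂ → ℂ) (a b T : ℝ) :
    rectIntegral (fun u => c * f u) a b T = c * rectIntegral f a b T := by
  simp only [rectIntegral, intervalIntegral.integral_const_mul]
  ring

lemma rectIntegral_congr {f g : ℂ → ℂ} {a b T p : ℝ} (ha : a < p) (hb : p < b) (hT : 0 < T)
    (h : EqOn f g (([[a, b]] ×ℂ [[-T, T]]) \ {(p : ℂ)})) :
    rectIntegral f a b T = rectIntegral g a b T := by
  obtain ⟨h1, h2, h3, h4⟩ := rect_sides_mem ha hb hT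
  unfold rectIntegral
  rw [intervalIntegral.integral_congr fun x hx => h (h1 x hx),
    intervalIntegral.integral_congr fun x hx => h (h2 x hx),
    intervalIntegral.integral_congr fun x hx => h (h3 x hx),
    intervalIntegral.integral_congr fun x hx => h (h4 x hx)]

/-- If `f` has a primitive off `p`, its integral over the boundary of a rectangle vanishes. -/
lemma rectIntegral_eq_zero_of_hasDerivAt {f F : ℂ → ℂ} {a b T p : ℝ} (ha : a < p) (hb : p < b)
    (hT : 0 < T) (hF : ∀ u, u ≠ (p : ℂ) → HasDerivAt F (f u) u)
    (hf : ContinuousOn f {(p : ℂ)}ᶜ) : rectIntegral f a b T = 0 := by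
  obtain ⟨h1, h2, h3, h4⟩ := rect_sides_mem ha hb hT
  have hor : ∀ c : ℂ, (∀ x ∈ [[a, b]], (x + c : ℂ) ≠ p) →
      ∫ x : ℝ in a..b, f (x + c) = F (b + c) - F (a + c) := fun c hc => by
    refine intervalIntegral.integral_eq_sub_of_hasDerivAt (f := fun x : ℝ => F (x + c))
      (fun x hx => ?_) ?_
    · have := (hF _ (hc x hx)).comp (x : ℂ) ((hasDerivAt_id (x : ℂ)).add_const c)
      simpa using this.comp_ofReal
    · exact (hf.comp (by fun_prop : Continuous fun x : ℝ => (x + c : ℂ)).continuousOn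
        fun x hx => hc x hx).intervalIntegrable
  have ver : ∀ c : ℂ, (∀ y ∈ [[-T, T]], (c + y * I : ℂ) ≠ p) →
      I * ∫ y : ℝ in (-T)..T, f (c + y * I) = F (c + T * I) - F (c + (-T : ℝ) * I) :=
    fun c hc => by
    rw [← intervalIntegral.integral_const_mul]
    refine intervalIntegral.integral_eq_sub_of_hasDerivAt (f := fun y : ℝ => F (c + y * I))
      (fun y hy => ?_) ?_
    · have := (hF _ (hc y hy)).comp (y : ℂ) (((hasDerivAt_id (y : ℂ)).mul_const I).const_add c)
      simpa [mul_comm] using this.comp_ofReal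
    · exact (continuousOn_const.mul (hf.comp
        (by fun_prop : Continuous fun y : ℝ => (c + y * I : ℂ)).continuousOn
        fun x hx => hc x hx)).intervalIntegrable
  unfold rectIntegral
  rw [hor _ fun x hx => (h1 x hx).2, hor _ fun x hx => (h2 x hx).2,
    ver _ fun x hx => (h3 x hx).2, ver _ fun x hx => (h4 x hx).2]
  ring

lemma log_neg_of_im_pos {z : ℂ} (hz : 0 < z.im) : log (-z) = log z - Real.pi * I := by
  apply Complex.ext
  · simp [log_re]
  · simp [log_im, arg_neg_eq_arg_sub_pi_of_im_pos hz]

/-- The principal logarithm is a primitive on every side except the left one, which crosses its cut.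
There log(-z) serves instead, and it differs from log z by πi in opposite directions at the two left
corners; the mismatch adds up to 2πi. -/
lemma rectIntegral_inv {a b T p : ℝ} (ha : a < p) (hb : p < b) (hT : 0 < T) :
    rectIntegral (fun u => (u - p)⁻¹) a b T = 2 * Real.pi * I := by
  have hor : ∀ t : ℝ, t ≠ 0 → ∫ x : ℝ in a..b, ((x + t * I : ℂ) - p)⁻¹ =
      log (b + t * I - p) - log (a + t * I - p) := fun t ht => by
    have hs : ∀ x : ℝ, (x + t * I - p : ℂ) ∈ slitPlane := fun x => Or.inr (by simpa using ht)
    refine intervalIntegral.integral_eq_sub_of_hasDerivAt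
      (f := fun x : ℝ => log (x + t * I - p)) (fun x hx => ?_) ?_
    · have := (((hasDerivAt_id (x : ℂ)).add_const (t * I)).sub_const (p : ℂ)).clog (hs x)
      simpa using this.comp_ofReal
    · exact (ContinuousOn.inv₀ (by fun_prop) fun x _ => slitPlane_ne_zero (hs x)).intervalIntegrable
  have hR : I * ∫ y : ℝ in (-T)..T, ((b + y * I : ℂ) - p)⁻¹ =
      log (b + T * I - p) - log (b + (-T : ℝ) * I - p) := by
    have hs : ∀ y : ℝ, (b + y * I - p : ℂ) ∈ slitPlane := fun y => Or.inl (by simpa using hb)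
    rw [← intervalIntegral.integral_const_mul]
    refine intervalIntegral.integral_eq_sub_of_hasDerivAt
      (f := fun y : ℝ => log (b + y * I - p)) (fun y hy => ?_) ?_
    · have := ((((hasDerivAt_id (y : ℂ)).mul_const I).const_add (b : ℂ)).sub_const (p : ℂ)).clog
        (hs y)
      simpa [div_eq_mul_inv] using this.comp_ofReal
    · exact (continuousOn_const.mul (ContinuousOn.inv₀ (by fun_prop)
        fun x _ => slitPlane_ne_zero (hs x))).intervalIntegrable
  have hL : I * ∫ y : ℝ in (-T)..T, ((a + y * I : ℂ) - p)⁻¹ =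
      log (-(a + T * I - p)) - log (-(a + (-T : ℝ) * I - p)) := by
    have hs : ∀ y : ℝ, -(a + y * I - p : ℂ) ∈ slitPlane := fun y => Or.inl (by simpa using ha)
    rw [← intervalIntegral.integral_const_mul]
    refine intervalIntegral.integral_eq_sub_of_hasDerivAt
      (f := fun y : ℝ => log (-(a + y * I - p))) (fun y hy => ?_) ?_
    · have := ((((hasDerivAt_id (y : ℂ)).mul_const I).const_add (a : ℂ)).sub_const
        (p : ℂ)).neg.clog (hs y)
      refine this.comp_ofReal.congr_deriv ?_
      change -(1 * I) / -(a + y * I - p : ℂ) = _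
      rw [neg_div_neg_eq, one_mul, div_eq_mul_inv]
    · exact (continuousOn_const.mul (ContinuousOn.inv₀ (by fun_prop)
        fun x _ => neg_ne_zero.1 (slitPlane_ne_zero (hs x)))).intervalIntegrable
  unfold rectIntegral
  rw [hor _ (by simpa using hT.ne'), hor _ hT.ne', hR, hL,
    log_neg_of_im_pos (z := a + T * I - p) (by simpa using hT)]
  have h2 := log_neg_of_im_pos (z := -(a + (-T : ℝ) * I - p)) (by simpa using hT)
  rw [neg_neg] at h2
  rw [h2]
  ring

/-- Induction on the pole order: `dslope` splits off h(p)/(u - p)^(n+1) and leaves a holomorphic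
numerator over (u - p)^n. The split-off term gives 2πi h(p) on both curves if n = 0 and has a
primitive otherwise. -/
lemma rectIntegral_div_pow {h : ℂ → ℂ} {a b T p r : ℝ} (n : ℕ) (ha : a < p) (hb : p < b)
    (hT : 0 < T) (hr : 0 < r) (hsub : Metric.closedBall (p : ℂ) r ⊆ [[a, b]] ×ℂ [[-T, T]])
    (hh : DifferentiableOn ℂ h ([[a, b]] ×ℂ [[-T, T]])) :
    rectIntegral (fun u => h u * ((u - p) ^ n)⁻¹) a b T =
      circleIntegral (fun u => h u * ((u - p) ^ n)⁻¹) p r := by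
  induction n generalizing h with
  | zero =>
    simp only [pow_zero, inv_one, mul_one]
    rw [rectIntegral_eq_zero hh, DiffContOnCl.circleIntegral_eq_zero hr.le]
    exact (hh.mono hsub).diffContOnCl_ball subset_rfl
  | succ n ih =>
    have hnhd : ([[a, b]] ×ℂ [[-T, T]]) ∈ 𝓝 (p : ℂ) :=
      Filter.mem_of_superset (Metric.closedBall_mem_nhds _ hr) hsub
    have hd : DifferentiableOn ℂ (dslope h p) ([[a, b]] ×ℂ [[-T, T]]) :=
      (Complex.differentiableOn_dslope hnhd).2 hh
    have hne : ∀ u ∈ ({(p : ℂ)}ᶜ : Set ℂ), u - p ≠ 0 := fun u hu => sub_ne_zero.2 hu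
    have hpc : ∀ m : ℕ, ContinuousOn (fun u : ℂ => ((u - p) ^ m)⁻¹) {(p : ℂ)}ᶜ := fun m =>
      ContinuousOn.inv₀ (by fun_prop) fun u hu => pow_ne_zero _ (hne u hu)
    have hsplit : EqOn (fun u => h u * ((u - p) ^ (n + 1))⁻¹)
        (fun u => h p * ((u - p) ^ (n + 1))⁻¹ + dslope h p u * ((u - p) ^ n)⁻¹)
        {(p : ℂ)}ᶜ := fun u hu => by
      have h0 := hne u hu
      simp only [dslope_of_ne h hu, slope_def_field]
      field_simp
      ring
    have hcs : Metric.sphere (p : ℂ) r ⊆ {(p : ℂ)}ᶜ := fun u hu hup => by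
      rw [mem_singleton_iff.1 hup] at hu
      simp at hu
      exact hr.ne hu
    have hcs' : Metric.sphere (p : ℂ) r ⊆ [[a, b]] ×ℂ [[-T, T]] :=
      Metric.sphere_subset_closedBall.trans hsub
    have hc1 : ContinuousOn (fun u : ℂ => h p * ((u - p) ^ (n + 1))⁻¹) {(p : ℂ)}ᶜ :=
      continuousOn_const.mul (hpc _)
    have hc2 : ContinuousOn (fun u => dslope h p u * ((u - p) ^ n)⁻¹)
        (([[a, b]] ×ℂ [[-T, T]]) \ {(p : ℂ)}) :=
      (hd.continuousOn.mono fun u hu => hu.1).mul ((hpc _).mono fun u hu => hu.2)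
    rw [rectIntegral_congr ha hb hT (hsplit.mono fun u hu => hu.2),
      rectIntegral_add ha hb hT (hc1.mono fun u hu => hu.2) hc2,
      ih hd, circleIntegral.integral_congr hr.le (hsplit.mono hcs),
      circleIntegral.integral_add ((hc1.mono hcs).circleIntegrable hr.le)
        ((hc2.mono fun u hu => ⟨hcs' hu, hcs hu⟩).circleIntegrable hr.le)]
    congr 1
    rw [rectIntegral_const_mul, circleIntegral.integral_const_mul]
    congr 1
    rcases Nat.eq_zero_or_pos n with rfl | hn
    · simp only [zero_add, pow_one]
      rw [rectIntegral_inv ha hb hT, circleIntegral.integral_sub_center_inv _ hr.ne']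
    · have hz : ∀ u : ℂ, ((u - p) ^ (n + 1))⁻¹ = (u - p) ^ (-(n + 1 : ℕ) : ℤ) := fun u => by
        rw [zpow_neg, zpow_natCast]
      simp only [hz]
      rw [circleIntegral.integral_sub_zpow_of_ne (by omega)]
      refine rectIntegral_eq_zero_of_hasDerivAt ha hb hT
        (F := fun u => (u - p) ^ (-(n : ℤ)) / (-(n : ℤ) : ℂ)) (fun u hu => ?_) ?_
      · have h1 := ((hasDerivAt_zpow (-(n : ℤ)) (u - p) (Or.inl (hne u hu))).comp u
          ((hasDerivAt_id u).sub_const (p : ℂ))).div_const (-(n : ℤ) : ℂ)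
        have hn0 : (n : ℂ) ≠ 0 := by exact_mod_cast hn.ne'
        have he : (-(n + 1 : ℕ) : ℤ) = -(n : ℤ) - 1 := by push_cast; ring
        rw [he]
        refine h1.congr_deriv ?_
        push_cast
        rw [mul_one, mul_div_cancel_left₀ _ (neg_ne_zero.2 hn0)]
      · simp only [← hz]; exact hpc _

/-- `2πi` times the residue of `f` at `w`: the integral over all sufficiently small circles. -/
def loopIntegral (f : ℂ → ℂ) (w : ℂ) : ℂ :=
  limUnder (𝓝[>] (0 : ℝ)) fun r => circleIntegral f w r

lemma circleIntegral_eq_loopIntegral {f : ℂ → ℂ} {w : ℂ} {r : ℝ} (hr : 0 < r)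
    (hf : ∀ u, u ≠ w → dist u w ≤ r → DifferentiableAt ℂ f u) :
    circleIntegral f w r = loopIntegral f w := by
  have h : ∀ᶠ r' in 𝓝[>] (0 : ℝ), circleIntegral f w r' = circleIntegral f w r := by
    filter_upwards [Ioo_mem_nhdsGT hr] with r' hr'
    refine (circleIntegral_eq_of_differentiable_on_annulus_off_countable hr'.1 hr'.2.le
      countable_empty ?_ ?_).symm
    · intro u hu
      refine (hf u (fun h => ?_) (by simpa using hu.1)).continuousAt.continuousWithinAt
      exact hu.2 (by simpa [h] using hr'.1)
    · intro u hu
      refine hf u (fun h => ?_) (by simpa using hu.1.1.le)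
      exact hu.1.2 (by simpa [h] using hr'.1.le)
  exact (Tendsto.limUnder_eq (Tendsto.congr' (EventuallyEq.symm h) tendsto_const_nhds)).symm

lemma loopIntegral_eq_zero {f : ℂ → ℂ} {w : ℂ} {r : ℝ} (hr : 0 < r)
    (hf : ∀ u, dist u w ≤ r → DifferentiableAt ℂ f u) : loopIntegral f w = 0 := by
  rw [← circleIntegral_eq_loopIntegral hr fun u _ hu => hf u hu]
  refine DiffContOnCl.circleIntegral_eq_zero hr.le
    (DifferentiableOn.diffContOnCl_ball (U := Metric.closedBall w r) (fun u hu => ?_) subset_rfl)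
  exact (hf u hu).differentiableWithinAt

/-- Meromorphy supplies a power (u - p)^n making f regular at p; dividing by it again reduces to the
previous computation. -/
lemma rectIntegral_eq_loopIntegral {f : ℂ → ℂ} {a b T p : ℝ} (ha : a < p) (hb : p < b)
    (hT : 0 < T) (hm : MeromorphicAt f p)
    (hf : ∀ u ∈ [[a, b]] ×ℂ [[-T, T]], u ≠ p → DifferentiableAt ℂ f u) :
    rectIntegral f a b T = loopIntegral f p := by
  obtain ⟨n, hn⟩ := hm
  have hnhd : ([[a, b]] ×ℂ [[-T, T]]) ∈ 𝓝 (p : ℂ) := by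
    rw [uIcc_of_le (ha.trans hb).le, uIcc_of_le (by linarith)]
    exact inter_mem (continuous_re.continuousAt (Icc_mem_nhds (by simpa) (by simpa)))
      (continuous_im.continuousAt (Icc_mem_nhds (by simpa) (by simpa)))
  obtain ⟨r, hr, hsub⟩ := Metric.nhds_basis_closedBall.mem_iff.1 hnhd
  have hh : DifferentiableOn ℂ (fun u : ℂ => (u - p) ^ n • f u) ([[a, b]] ×ℂ [[-T, T]]) := by
    intro u hu
    by_cases hup : u = p
    · rw [hup]; exact hn.differentiableAt.differentiableWithinAt
    · exact (DifferentiableAt.smul (f := f) (c := fun u => (u - p) ^ n) (by fun_prop)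
        (hf u hu hup)).differentiableWithinAt
  have heq : EqOn (fun u : ℂ => ((u - p) ^ n • f u) * ((u - p) ^ n)⁻¹) f {(p : ℂ)}ᶜ := fun u hu => by
    have h0 : u - p ≠ 0 := sub_ne_zero.2 hu
    simp only [smul_eq_mul]
    field_simp
  rw [← rectIntegral_congr ha hb hT (heq.mono fun u hu => hu.2),
    rectIntegral_div_pow n ha hb hT hr hsub hh,
    ← circleIntegral_eq_loopIntegral hr fun u hu hur => hf u (hsub hur) hu]
  refine circleIntegral.integral_congr hr.le (heq.mono ?_)
  intro u hu hup
  rw [mem_singleton_iff.1 hup] at hu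
  simp at hu
  exact hr.ne hu

end FoxH

/-! ### Moving vertical contours across real poles -/

namespace FoxH

lemma integrable_of_norm_le_div_sq {g : ℝ → ℂ} (hc : Continuous g) {C : ℝ}
    (hC : ∀ t : ℝ, 1 ≤ |t| → ‖g t‖ ≤ C / t ^ 2) : Integrable g := by
  obtain ⟨M, hM⟩ := (isCompact_Icc (a := (-1 : ℝ)) (b := 1)).exists_bound_of_continuousOn
    hc.continuousOn
  -- The factor 2 comes from 1 + t² ≤ 2 max(1, t²).
  refine Integrable.mono' (integrable_inv_one_add_sq.const_mul (2 * max M C))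
    hc.aestronglyMeasurable (Eventually.of_forall fun t => ?_)
  have hpos : 0 < 1 + t ^ 2 := by positivity
  rw [← div_eq_mul_inv, le_div_iff₀ hpos]
  rcases le_total |t| 1 with ht | ht
  · have h1 := hM t (abs_le.1 ht)
    have h2 : t ^ 2 ≤ 1 := (sq_le_one_iff_abs_le_one t).2 ht
    have h3 : ‖g t‖ ≤ max M C := h1.trans (le_max_left _ _)
    nlinarith [norm_nonneg (g t)]
  · have h1 := hC t ht
    have h2 : 1 ≤ t ^ 2 := (one_le_sq_iff_one_le_abs t).2 ht
    rw [le_div_iff₀ (by linarith)] at h1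
    have h3 : ‖g t‖ * t ^ 2 ≤ max M C := h1.trans (le_max_right _ _)
    nlinarith [norm_nonneg (g t)]

/-- `f` is a Mellin-Barnes integrand whose poles, all real, lie in `QL` (bounded to the right) and
`QR` (bounded to the left), with decay at `±i∞`. -/
structure IsMellinBarnes (QL QR : Set ℂ) (f : ℂ → ℂ) : Prop where
  disjoint : Disjoint QL QR
  im_eq_zero : ∀ w ∈ QL ∪ QR, w.im = 0
  finite_left : ∀ γ : ℝ, {w ∈ QL | γ < w.re}.Finite
  finite_right : ∀ γ : ℝ, {w ∈ QR | w.re < γ}.Finite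
  meromorphicAt : ∀ w, MeromorphicAt f w
  differentiableAt : ∀ u, u ∉ QL ∪ QR → DifferentiableAt ℂ f u
  decay : ∀ a b : ℝ, ∃ C : ℝ, ∀ x ∈ Icc a b, ∀ t : ℝ, 1 ≤ |t| → ‖f (x + t * I)‖ ≤ C / t ^ 2

/-- The integral of `f` along the upward line `Re u = γ`. -/
def lineIntegral (f : ℂ → ℂ) (γ : ℝ) : ℂ := ∫ t : ℝ, f (γ + t * I) * I

namespace IsMellinBarnes

variable {QL QR : Set ℂ} {f : ℂ → ℂ}

lemma integrable_line (hf : IsMellinBarnes QL QR f) {γ : ℝ} (hγ : ∀ w ∈ QL ∪ QR, w.re ≠ γ) :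
    Integrable fun t : ℝ => f (γ + t * I) := by
  obtain ⟨C, hC⟩ := hf.decay γ γ
  refine integrable_of_norm_le_div_sq (continuous_iff_continuousAt.2 fun t => ?_)
    (hC γ ⟨le_rfl, le_rfl⟩)
  have hd := hf.differentiableAt (γ + t * I) fun h => hγ _ h (by simp)
  exact hd.continuousAt.comp (f := fun t : ℝ => (γ + t * I : ℂ))
    (by fun_prop : Continuous fun t : ℝ => (γ + t * I : ℂ)).continuousAt

/-- As T → ∞ the quadratic decay kills the horizontal sides, and the vertical sides tend to the full
line integrals. -/
lemma lineIntegral_sub_of_rectIntegral (hf : IsMellinBarnes QL QR f) {a b : ℝ} {R : ℂ}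
    (hab : a < b) (ha : ∀ w ∈ QL ∪ QR, w.re ≠ a) (hb : ∀ w ∈ QL ∪ QR, w.re ≠ b)
    (hR : ∀ T : ℝ, 1 ≤ T → rectIntegral f a b T = R) :
    lineIntegral f b - lineIntegral f a = R := by
  obtain ⟨C, hC⟩ := hf.decay a b
  have hhor : ∀ s : ℝ, |s| = 1 →
      Tendsto (fun T : ℝ => ∫ x : ℝ in a..b, f (x + (s * T : ℝ) * I)) atTop (𝓝 0) := by
    intro s hs
    have hlim : Tendsto (fun T : ℝ => C / T ^ 2 * |b - a|) atTop (𝓝 0) := by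
      have := (tendsto_const_nhds (x := C)).div_atTop (tendsto_pow_atTop (α := ℝ) two_ne_zero)
      simpa using this.mul_const |b - a|
    refine squeeze_zero_norm' ?_ hlim
    filter_upwards [eventually_ge_atTop 1] with T hT
    refine intervalIntegral.norm_integral_le_of_norm_le_const fun x hx => ?_
    rw [uIoc_of_le hab.le] at hx
    have habs : |s * T| = T := by rw [abs_mul, hs, one_mul, abs_of_nonneg (by linarith)]
    have := hC x ⟨hx.1.le, hx.2⟩ (s * T) (by rw [habs]; exact hT)
    rwa [← sq_abs (s * T), habs] at this
  have hver : ∀ γ : ℝ, (∀ w ∈ QL ∪ QR, w.re ≠ γ) →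
      Tendsto (fun T : ℝ => I * ∫ y : ℝ in (-T)..T, f (γ + y * I)) atTop
        (𝓝 (lineIntegral f γ)) := by
    intro γ hγ
    have := (intervalIntegral_tendsto_integral (hf.integrable_line hγ) tendsto_neg_atTop_atBot
      tendsto_id).const_mul I
    rw [lineIntegral, integral_mul_const, mul_comm _ I]
    exact this
  have hlim := (((hhor (-1) (by simp)).sub (hhor 1 (by simp))).add (hver b hb)).sub (hver a ha)
  simp only [sub_zero, zero_add, neg_one_mul, one_mul] at hlim
  refine tendsto_nhds_unique hlim (tendsto_const_nhds.congr' ?_)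
  filter_upwards [eventually_ge_atTop 1] with T hT
  exact (hR T hT).symm

lemma finite_strip (hf : IsMellinBarnes QL QR f) (a b : ℝ) :
    {w ∈ QL ∪ QR | a < w.re ∧ w.re < b}.Finite := by
  refine ((hf.finite_left a).union (hf.finite_right b)).subset ?_
  rintro w ⟨hw | hw, h1, h2⟩
  · exact Or.inl ⟨hw, h1⟩
  · exact Or.inr ⟨hw, h2⟩

/-- Strong induction on the number of poles in the strip. As all poles are real, two distinct ones
have distinct real parts, so a vertical line between them cuts the strip into two with fewer poles
each. One pole is the rectangle residue computation. -/
lemma lineIntegral_sub (hf : IsMellinBarnes QL QR f) {a b : ℝ}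
    (hab : a < b) (ha : ∀ w ∈ QL ∪ QR, w.re ≠ a) (hb : ∀ w ∈ QL ∪ QR, w.re ≠ b) :
    lineIntegral f b - lineIntegral f a =
      ∑ᶠ w ∈ {w ∈ QL ∪ QR | a < w.re ∧ w.re < b}, loopIntegral f w := by
  induction hn : {w ∈ QL ∪ QR | a < w.re ∧ w.re < b}.ncard using Nat.strong_induction_on
    generalizing a b with
  | _ n ih =>
  have hnot : ∀ T u, u ∈ [[a, b]] ×ℂ [[-T, T]] →
      u ∉ {w ∈ QL ∪ QR | a < w.re ∧ w.re < b} → DifferentiableAt ℂ f u := by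
    intro T u hu hu'
    refine hf.differentiableAt u fun h => hu' ⟨h, ?_⟩
    have h1 := (mem_reProdIm.1 hu).1
    rw [uIcc_of_le hab.le] at h1
    exact ⟨lt_of_le_of_ne h1.1 (ha u h).symm, lt_of_le_of_ne h1.2 (hb u h)⟩
  have hfin := hf.finite_strip a b
  rcases Set.eq_empty_or_nonempty {w ∈ QL ∪ QR | a < w.re ∧ w.re < b} with h0 | ⟨p, hp⟩
  · rw [h0, finsum_mem_empty]
    refine hf.lineIntegral_sub_of_rectIntegral hab ha hb fun T hT => rectIntegral_eq_zero ?_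
    exact fun u hu => (hnot T u hu (by rw [h0]; exact notMem_empty u)).differentiableWithinAt
  by_cases h1 : {w ∈ QL ∪ QR | a < w.re ∧ w.re < b} = {p}
  · rw [h1, finsum_mem_singleton]
    have hpr : ((p.re : ℝ) : ℂ) = p := Complex.ext (by simp) (by simp [hf.im_eq_zero p hp.1])
    refine hf.lineIntegral_sub_of_rectIntegral hab ha hb fun T hT => ?_
    have := rectIntegral_eq_loopIntegral (f := f) (T := T) hp.2.1 hp.2.2 (by linarith)
      (hf.meromorphicAt _) fun u hu hup => hnot T u hu (by rw [h1]; simpa [hpr] using hup)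
    rwa [hpr] at this
  obtain ⟨p, hp, q, hq, hpq⟩ : ∃ p ∈ {w ∈ QL ∪ QR | a < w.re ∧ w.re < b},
      ∃ q ∈ {w ∈ QL ∪ QR | a < w.re ∧ w.re < b}, p.re < q.re := by
    obtain ⟨q, hq, hqp⟩ : ∃ q ∈ {w ∈ QL ∪ QR | a < w.re ∧ w.re < b}, q ≠ p := by
      by_contra! h
      exact h1 (Set.eq_singleton_iff_unique_mem.2 ⟨hp, h⟩)
    have hre : q.re ≠ p.re := fun h => hqp
      (Complex.ext h (by rw [hf.im_eq_zero p hp.1, hf.im_eq_zero q hq.1]))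
    rcases lt_or_gt_of_ne hre with h | h
    · exact ⟨q, hq, p, hp, h⟩
    · exact ⟨p, hp, q, hq, h⟩
  obtain ⟨c, hc, hcn⟩ : ∃ c ∈ Ioo p.re q.re,
      c ∉ Complex.re '' {w ∈ QL ∪ QR | a < w.re ∧ w.re < b} :=
    ((Ioo_infinite hpq).sdiff (hfin.image _)).nonempty.imp fun c hc => ⟨hc.1, hc.2⟩
  have hac : a < c := hp.2.1.trans hc.1
  have hcb : c < b := hc.2.trans hq.2.2
  have hcQ : ∀ w ∈ QL ∪ QR, w.re ≠ c := fun w hw h =>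
    hcn ⟨w, ⟨hw, by rw [h]; exact hac, by rw [h]; exact hcb⟩, h⟩
  have hL : {w ∈ QL ∪ QR | a < w.re ∧ w.re < c} ⊆ {w ∈ QL ∪ QR | a < w.re ∧ w.re < b} :=
    fun w hw => ⟨hw.1, hw.2.1, hw.2.2.trans hcb⟩
  have hR : {w ∈ QL ∪ QR | c < w.re ∧ w.re < b} ⊆ {w ∈ QL ∪ QR | a < w.re ∧ w.re < b} :=
    fun w hw => ⟨hw.1, hac.trans hw.2.1, hw.2.2⟩
  have e1 := ih _ (hn ▸ Set.ncard_lt_ncard ⟨hL, fun h => lt_asymm hc.2 (h hq).2.2⟩ hfin)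
    hac ha hcQ rfl
  have e2 := ih _ (hn ▸ Set.ncard_lt_ncard ⟨hR, fun h => lt_asymm hc.1 (h hp).2.1⟩ hfin)
    hcb hcQ hb rfl
  have e : {w ∈ QL ∪ QR | a < w.re ∧ w.re < b} =
      {w ∈ QL ∪ QR | a < w.re ∧ w.re < c} ∪ {w ∈ QL ∪ QR | c < w.re ∧ w.re < b} := by
    refine Subset.antisymm (fun w h => ?_) (union_subset hL hR)
    rcases lt_or_gt_of_ne (hcQ w h.1) with h' | h'
    · exact Or.inl ⟨h.1, h.2.1, h'⟩
    · exact Or.inr ⟨h.1, h', h.2.2⟩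
  rw [e, finsum_mem_union _ (hfin.subset hL) (hfin.subset hR), ← e1, ← e2]
  · ring
  · exact Set.disjoint_left.2 fun w h h' => lt_asymm h.2.2 h'.2.1

/-- The line integral corrected by the residues at the poles on the wrong side of the line. -/
def correctedIntegral (QL QR : Set ℂ) (f : ℂ → ℂ) (γ : ℝ) : ℂ :=
  lineIntegral f γ + (∑ᶠ w ∈ {w ∈ QL | γ < w.re}, loopIntegral f w) -
    ∑ᶠ w ∈ {w ∈ QR | w.re < γ}, loopIntegral f w

/-- Moving the line from a to b gains the loops of all poles in between. Those in QL leave the first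
correction sum, and those in QR enter the sum that is subtracted, so the total is unchanged. -/
lemma correctedIntegral_eq_of_lt (hf : IsMellinBarnes QL QR f) {a b : ℝ}
    (hab : a < b) (ha : ∀ w ∈ QL ∪ QR, w.re ≠ a) (hb : ∀ w ∈ QL ∪ QR, w.re ≠ b) :
    correctedIntegral QL QR f a = correctedIntegral QL QR f b := by
  have h := hf.lineIntegral_sub hab ha hb
  have hLf : {w ∈ QL | a < w.re ∧ w.re < b}.Finite :=
    (hf.finite_left a).subset fun w hw => ⟨hw.1, hw.2.1⟩
  have hRf : {w ∈ QR | a < w.re ∧ w.re < b}.Finite :=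
    (hf.finite_right b).subset fun w hw => ⟨hw.1, hw.2.2⟩
  have e : {w ∈ QL ∪ QR | a < w.re ∧ w.re < b} =
      {w ∈ QL | a < w.re ∧ w.re < b} ∪ {w ∈ QR | a < w.re ∧ w.re < b} := by
    ext w; simp only [mem_ofPred_eq, mem_union]; tauto
  have eL : {w ∈ QL | a < w.re} = {w ∈ QL | a < w.re ∧ w.re < b} ∪ {w ∈ QL | b < w.re} := by
    ext w
    constructor
    · rintro ⟨h1, h2⟩
      rcases lt_or_gt_of_ne (hb w (Or.inl h1)) with h' | h'
      · exact Or.inl ⟨h1, h2, h'⟩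
      · exact Or.inr ⟨h1, h'⟩
    · rintro (h' | h')
      · exact ⟨h'.1, h'.2.1⟩
      · exact ⟨h'.1, hab.trans h'.2⟩
  have eR : {w ∈ QR | w.re < b} = {w ∈ QR | a < w.re ∧ w.re < b} ∪ {w ∈ QR | w.re < a} := by
    ext w
    constructor
    · rintro ⟨h1, h2⟩
      rcases lt_or_gt_of_ne (ha w (Or.inr h1)) with h' | h'
      · exact Or.inr ⟨h1, h'⟩
      · exact Or.inl ⟨h1, h', h2⟩
    · rintro (h' | h')
      · exact ⟨h'.1, h'.2.2⟩
      · exact ⟨h'.1, h'.2.trans hab⟩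
  rw [e, finsum_mem_union _ hLf hRf] at h
  · unfold correctedIntegral
    rw [eL, eR, finsum_mem_union _ hLf (hf.finite_left b),
      finsum_mem_union _ hRf (hf.finite_right a)]
    · linear_combination -h
    · exact Set.disjoint_left.2 fun w h h' => lt_asymm h.2.1 h'.2
    · exact Set.disjoint_left.2 fun w h h' => lt_asymm h.2.2 h'.2
  · exact Set.disjoint_left.2 fun w h h' => Set.disjoint_left.1 hf.disjoint h.1 h'.1

lemma correctedIntegral_eq (hf : IsMellinBarnes QL QR f) {a b : ℝ}
    (ha : ∀ w ∈ QL ∪ QR, w.re ≠ a) (hb : ∀ w ∈ QL ∪ QR, w.re ≠ b) :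
    correctedIntegral QL QR f a = correctedIntegral QL QR f b := by
  rcases lt_trichotomy a b with h | rfl | h
  · exact hf.correctedIntegral_eq_of_lt h ha hb
  · rfl
  · exact (hf.correctedIntegral_eq_of_lt h hb ha).symm

/-- Each ε-disc contains no pole but its centre, so its circle integral is the loop integral there.
Points listed in PL or PR at which f is regular contribute zero, which permits the larger sets. -/
lemma contourIntegral_eq_correctedIntegral (hf : IsMellinBarnes QL QR f) {PL PR : Set ℂ}
    {γ ε : ℝ} (hsep : IsSeparating PL PR γ ε) (hL : QL ⊆ PL) (hR : QR ⊆ PR) :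
    contourIntegral PL PR γ ε f = (2 * Real.pi * I)⁻¹ * correctedIntegral QL QR f γ := by
  obtain ⟨hdisj, hε, -, hsep⟩ := hsep
  have hcirc : ∀ w ∈ {w ∈ PL | γ < w.re} ∪ {w ∈ PR | w.re < γ},
      ∀ u, u ≠ w → dist u w ≤ ε → DifferentiableAt ℂ f u := fun w hw u hu hd =>
    hf.differentiableAt u fun h => (hsep w hw u (union_subset_union hL hR h) hu).not_ge hd
  have hzero : ∀ w ∈ {w ∈ PL | γ < w.re} ∪ {w ∈ PR | w.re < γ}, w ∉ QL ∪ QR →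
      loopIntegral f w = 0 := fun w hw hwQ => by
    refine loopIntegral_eq_zero hε fun u hu => ?_
    by_cases h : u = w
    · rw [h]; exact hf.differentiableAt w hwQ
    · exact hcirc w hw u h hu
  have eL : (∑ᶠ w ∈ {w ∈ PL | γ < w.re}, circleIntegral f w ε) =
      ∑ᶠ w ∈ {w ∈ QL | γ < w.re}, loopIntegral f w := by
    rw [finsum_mem_congr rfl fun w hw =>
      circleIntegral_eq_loopIntegral hε (hcirc w (Or.inl hw))]
    refine finsum_mem_inter_support_eq _ _ _ (Set.ext fun w => ⟨fun h => ⟨⟨?_, h.1.2⟩, h.2⟩,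
      fun h => ⟨⟨hL h.1.1, h.1.2⟩, h.2⟩⟩)
    by_contra hw
    exact h.2 (hzero w (Or.inl h.1) fun h' => h'.elim hw fun h' =>
      Set.disjoint_left.1 hdisj h.1.1 (hR h'))
  have eR : (∑ᶠ w ∈ {w ∈ PR | w.re < γ}, circleIntegral f w ε) =
      ∑ᶠ w ∈ {w ∈ QR | w.re < γ}, loopIntegral f w := by
    rw [finsum_mem_congr rfl fun w hw =>
      circleIntegral_eq_loopIntegral hε (hcirc w (Or.inr hw))]
    refine finsum_mem_inter_support_eq _ _ _ (Set.ext fun w => ⟨fun h => ⟨⟨?_, h.1.2⟩, h.2⟩,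
      fun h => ⟨⟨hR h.1.1, h.1.2⟩, h.2⟩⟩)
    by_contra hw
    exact h.2 (hzero w (Or.inr h.1) fun h' => h'.elim
      (fun h' => Set.disjoint_left.1 hdisj (hL h') h.1.1) hw)
  rw [contourIntegral, eL, eR, correctedIntegral, lineIntegral]

/-- The Mellin-Barnes integral does not depend on the separating contour, nor on points listed as
poles where the integrand is regular. -/
theorem contourIntegral_eq (hf : IsMellinBarnes QL QR f) {PL PR PL' PR' : Set ℂ}
    {γ ε γ' ε' : ℝ} (hsep : IsSeparating PL PR γ ε) (hL : QL ⊆ PL) (hR : QR ⊆ PR)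
    (hsep' : IsSeparating PL' PR' γ' ε') (hL' : QL ⊆ PL') (hR' : QR ⊆ PR') :
    contourIntegral PL PR γ ε f = contourIntegral PL' PR' γ' ε' f := by
  rw [hf.contourIntegral_eq_correctedIntegral hsep hL hR,
    hf.contourIntegral_eq_correctedIntegral hsep' hL' hR',
    hf.correctedIntegral_eq (fun w hw => hsep.2.2.1 w (union_subset_union hL hR hw))
      (fun w hw => hsep'.2.2.1 w (union_subset_union hL' hR' hw))]

/-- The line and the circles avoid all of PL ∪ PR, so an identity of integrands off these sets
suffices, even if the summands have fewer poles than F. -/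
lemma mul_contourIntegral_eq_add {PL PR QL' QR' : Set ℂ} {F g : ℂ → ℂ} {γ ε : ℝ} {c : ℂ}
    (hF : IsMellinBarnes PL PR F) (hf : IsMellinBarnes QL QR f) (hg : IsMellinBarnes QL' QR' g)
    (hsep : IsSeparating PL PR γ ε) (hL : QL ⊆ PL) (hR : QR ⊆ PR) (hL' : QL' ⊆ PL) (hR' : QR' ⊆ PR)
    (h : ∀ u, u ∉ PL ∪ PR → c * F u = f u + g u) :
    c * contourIntegral PL PR γ ε F =
      contourIntegral PL PR γ ε f + contourIntegral PL PR γ ε g := by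
  obtain ⟨-, hε, hγ, hsep⟩ := hsep
  have hsub := union_subset_union hL hR
  have hsub' := union_subset_union hL' hR'
  have hline : c * ∫ t : ℝ, F (γ + t * I) * I =
      (∫ t : ℝ, f (γ + t * I) * I) + ∫ t : ℝ, g (γ + t * I) * I := by
    rw [← integral_const_mul, ← integral_add
      ((hf.integrable_line fun w hw => hγ w (hsub hw)).mul_const I)
      ((hg.integrable_line fun w hw => hγ w (hsub' hw)).mul_const I)]
    congr 1
    ext t
    rw [← mul_assoc, h _ fun hw => hγ _ hw (by simp), add_mul]
  have hcirc : ∀ w ∈ {w ∈ PL | γ < w.re} ∪ {w ∈ PR | w.re < γ},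
      c * circleIntegral F w ε = circleIntegral f w ε + circleIntegral g w ε := fun w hw => by
    have hnot : ∀ u ∈ Metric.sphere w ε, u ∉ PL ∪ PR := fun u hu hP => by
      rcases eq_or_ne u w with rfl | hne
      · rw [Metric.mem_sphere, dist_self] at hu
        exact hε.ne hu
      · exact (hsep w hw u hP hne).ne' hu
    rw [← circleIntegral.integral_const_mul, ← circleIntegral.integral_add]
    · exact circleIntegral.integral_congr hε.le fun u hu => h u (hnot u hu)
    · exact ContinuousOn.circleIntegrable hε.le fun u hu => (hf.differentiableAt u
        fun hw => hnot u hu (hsub hw)).continuousAt.continuousWithinAt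
    · exact ContinuousOn.circleIntegrable hε.le fun u hu => (hg.differentiableAt u
        fun hw => hnot u hu (hsub' hw)).continuousAt.continuousWithinAt
  have hsum : ∀ S : Set ℂ, S.Finite → S ⊆ {w ∈ PL | γ < w.re} ∪ {w ∈ PR | w.re < γ} →
      c * ∑ᶠ w ∈ S, circleIntegral F w ε =
        (∑ᶠ w ∈ S, circleIntegral f w ε) + ∑ᶠ w ∈ S, circleIntegral g w ε := fun S hS hsubS => by
    rw [← finsum_mem_add_distrib hS, finsum_mem_eq_finite_toFinset_sum _ hS,
      finsum_mem_eq_finite_toFinset_sum _ hS, Finset.mul_sum]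
    exact Finset.sum_congr rfl fun w hw => hcirc w (hsubS (hS.mem_toFinset.1 hw))
  have e1 := hsum _ (hF.finite_left γ) subset_union_left
  have e2 := hsum _ (hF.finite_right γ) subset_union_right
  unfold contourIntegral
  linear_combination (2 * Real.pi * I)⁻¹ * (hline + e1 - e2)

/-- Separating contours exist. -/
lemma exists_isSeparating (hf : IsMellinBarnes QL QR f) : ∃ γ ε, IsSeparating QL QR γ ε := by
  have hQc : (QL ∪ QR).Countable := by
    have : QL ∪ QR ⊆ ⋃ n : ℕ, {w ∈ QL ∪ QR | (-n : ℝ) < w.re ∧ w.re < n} := fun w hw => by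
      obtain ⟨n, hn⟩ := exists_nat_gt |w.re|
      exact mem_iUnion.2 ⟨n, hw, abs_lt.1 hn⟩
    exact (countable_iUnion fun n : ℕ => (hf.finite_strip _ _).countable).mono this
  -- The real parts of the poles are countable, so some abscissa avoids them.
  obtain ⟨γ, hγ⟩ := ((hQc.image Complex.re).dense_compl ℝ).nonempty
  have hγ' : ∀ w ∈ QL ∪ QR, w.re ≠ γ := fun w hw h => hγ ⟨w, hw, h⟩
  have hfin := (hf.finite_left γ).union (hf.finite_right γ)
  have hloc : ∀ w, ∃ δ > 0, ∀ w' ∈ QL ∪ QR, w' ≠ w → δ < dist w' w := fun w => by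
    have hF := (hf.finite_strip (w.re - 1) (w.re + 1)).subset (sdiff_subset (t := {w}))
    have hn := (hF.isClosed.isOpen_compl).mem_nhds (x := w) (by simp)
    obtain ⟨δ, hδ, hball⟩ := Metric.nhds_basis_closedBall.mem_iff.1 hn
    -- The bound 1/2 keeps any pole this close inside the strip of half-width 1, where only finitely
    -- many poles lie.
    refine ⟨min δ (1 / 2), by positivity, fun w' hw' hne => ?_⟩
    by_contra! hle
    have h1 : |w'.re - w.re| ≤ 1 / 2 := by
      rw [← sub_re]
      exact (abs_re_le_norm _).trans ((dist_eq_norm w' w ▸ hle).trans (min_le_right _ _))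
    rw [abs_le] at h1
    exact hball (Metric.mem_closedBall.2 (hle.trans (min_le_left _ _)))
      ⟨⟨hw', by linarith, by linarith⟩, hne⟩
  choose δ hδ hδ' using hloc
  obtain ⟨ε, hε, hεδ⟩ : ∃ ε > 0, ∀ w ∈ {w ∈ QL | γ < w.re} ∪ {w ∈ QR | w.re < γ}, ε ≤ δ w := by
    rcases ({w ∈ QL | γ < w.re} ∪ {w ∈ QR | w.re < γ}).eq_empty_or_nonempty with h0 | hne
    · exact ⟨1, one_pos, by simp [h0]⟩
    · obtain ⟨w, -, hw⟩ := exists_min_image _ δ hfin hne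
      exact ⟨δ w, hδ w, hw⟩
  exact ⟨γ, ε, hf.disjoint, hε, hγ', fun w hw w' hw' hne =>
    (hεδ w hw).trans_lt (hδ' w w' hw' hne)⟩

end IsMellinBarnes

end FoxH

/-! ### Poles and regularity of general Fox H integrands -/

namespace FoxH

section Poles

variable {p q : ℕ} {m n : ℕ} {a : Fin p → ℂ} {A : Fin p → ℝ} {b : Fin q → ℂ} {B : Fin q → ℝ}

lemma finite_leftPoles_gt (hB : ∀ j, 0 < B j) (γ : ℝ) :
    {w ∈ leftPoles m b B | γ < w.re}.Finite := by
  have hsub : {w ∈ leftPoles m b B | γ < w.re} ⊆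
      ⋃ j : Fin q, (fun k : ℕ => (-(k : ℂ) - b j) / B j) ''
        {k : ℕ | (k : ℝ) < -(b j).re - B j * γ} := by
    rintro w ⟨⟨j, k, -, hw⟩, hγ⟩
    have hBj : (B j : ℂ) ≠ 0 := ofReal_ne_zero.2 (hB j).ne'
    refine mem_iUnion.2 ⟨j, k, ?_, ?_⟩
    · have := congrArg Complex.re hw
      simp at this
      have := mul_lt_mul_of_pos_left hγ (hB j)
      simp only [mem_ofPred_eq]
      linarith
    · simp only [← hw]
      field_simp
      ring
  refine (finite_iUnion fun j => Finite.image _ ?_).subset hsub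
  obtain ⟨N, hN⟩ := exists_nat_gt (-(b j).re - B j * γ)
  exact (finite_lt_nat N).subset fun k hk => by
    have : (k : ℝ) < N := lt_trans hk hN
    exact_mod_cast this

lemma im_eq_zero_of_mem_leftPoles (hb : ∀ j, (b j).im = 0) (hB : ∀ j, 0 < B j) {w : ℂ}
    (hw : w ∈ leftPoles m b B) : w.im = 0 := by
  obtain ⟨j, k, -, hw⟩ := hw
  have := congrArg Complex.im hw
  simpa [hb j, (hB j).ne'] using this

lemma finite_rightPoles_lt (hA : ∀ i, 0 < A i) (γ : ℝ) :
    {w ∈ rightPoles n a A | w.re < γ}.Finite := by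
  refine ((finite_leftPoles_gt (m := n) (b := fun i => 1 - a i) (B := A) hA
    (-γ)).image fun w => -w).subset ?_
  rintro w ⟨⟨i, k, hi, hw⟩, hγ⟩
  refine ⟨-w, ⟨⟨i, k, hi, ?_⟩, by simpa using hγ⟩, by simp⟩
  rw [← hw]; ring

lemma im_eq_zero_of_mem_rightPoles (ha : ∀ i, (a i).im = 0) (hA : ∀ i, 0 < A i) {w : ℂ}
    (hw : w ∈ rightPoles n a A) : w.im = 0 := by
  obtain ⟨j, k, -, hw⟩ := hw
  have := congrArg Complex.im hw
  simpa [ha j, (hA j).ne'] using this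

/-- It is the inverse of the entire function 1/Γ composed with g. -/
lemma _root_.Complex.meromorphicAt_Gamma_comp {g : ℂ → ℂ} (hg : Differentiable ℂ g) (w : ℂ) :
    MeromorphicAt (fun u => Gamma (g u)) w := by
  have h : AnalyticAt ℂ (fun u => (Gamma (g u))⁻¹) w :=
    (differentiable_one_div_Gamma.comp hg).analyticAt w
  simpa using h.meromorphicAt.fun_inv

lemma meromorphicAt_integrand {z : ℂ} (hz : z ≠ 0) (w : ℂ) :
    MeromorphicAt (integrand m n a A b B z) w := by
  have hpow : MeromorphicAt (fun u : ℂ => z ^ (-u)) w :=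
    (Differentiable.analyticAt (differentiable_id.neg.const_cpow (Or.inl hz)) w).meromorphicAt
  unfold integrand kernel
  refine MeromorphicAt.fun_mul (MeromorphicAt.fun_mul (MeromorphicAt.fun_prod fun j _ => ?_)
    (MeromorphicAt.fun_prod fun i _ => ?_)) hpow
  · split_ifs
    · exact meromorphicAt_Gamma_comp (by fun_prop) w
    · exact (meromorphicAt_Gamma_comp (g := fun u => 1 - b j - B j * u) (by fun_prop) w).fun_inv
  · split_ifs
    · exact meromorphicAt_Gamma_comp (by fun_prop) w
    · exact (meromorphicAt_Gamma_comp (g := fun u => a i + A i * u) (by fun_prop) w).fun_inv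

lemma differentiableAt_integrand {z : ℂ} (hz : z ≠ 0) {u : ℂ}
    (hu : u ∉ leftPoles m b B ∪ rightPoles n a A) :
    DifferentiableAt ℂ (integrand m n a A b B z) u := by
  unfold integrand kernel
  refine DifferentiableAt.fun_mul (DifferentiableAt.fun_mul
    (DifferentiableAt.fun_finsetProd fun j _ => ?_)
    (DifferentiableAt.fun_finsetProd fun i _ => ?_))
    (differentiable_id.neg.const_cpow (Or.inl hz) u)
  · split_ifs with h
    · exact (differentiableAt_Gamma _ fun k hk => hu (Or.inl ⟨j, k, h, hk⟩)).comp u (by fun_prop)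
    · exact (differentiable_one_div_Gamma.comp
        (by fun_prop : Differentiable ℂ fun u => 1 - b j - B j * u)) u
  · split_ifs with h
    · exact (differentiableAt_Gamma _ fun k hk => hu (Or.inr ⟨i, k, h, hk⟩)).comp u (by fun_prop)
    · exact (differentiable_one_div_Gamma.comp
        (by fun_prop : Differentiable ℂ fun u => a i + A i * u)) u

end Poles

/-! ### Decay of the Gamma function on vertical strips -/

lemma norm_Gamma_le_Gamma_re {z : ℂ} (hz : 0 < z.re) : ‖Gamma z‖ ≤ Real.Gamma z.re := by
  rw [Gamma_eq_integral hz, GammaIntegral, Real.Gamma_eq_integral hz]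
  refine (norm_integral_le_integral_norm _).trans_eq
    (setIntegral_congr_fun measurableSet_Ioi fun x hx => ?_)
  have hx' : (0 : ℝ) < x := hx
  simp only [norm_mul, norm_cpow_eq_rpow_re_of_pos hx', norm_real, Real.norm_eq_abs,
    Real.abs_exp, sub_re, one_re]

/-- Each use of Γ(z + 1) = zΓ(z) yields a factor |z| ≥ |Im z|, until the argument reaches the right
half-plane. -/
lemma norm_Gamma_mul_abs_im_pow_le (n : ℕ) {z : ℂ} (hz : 0 < z.re + n) (him : z.im ≠ 0) :
    ‖Gamma z‖ * |z.im| ^ n ≤ Real.Gamma (z.re + n) := by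
  induction n generalizing z with
  | zero => simpa using norm_Gamma_le_Gamma_re (by simpa using hz)
  | succ n ih =>
    have h0 : z ≠ 0 := fun h => him (by simp [h])
    have h1 := ih (z := z + 1) (by push_cast at hz; simp; linarith) (by simpa using him)
    rw [Gamma_add_one z h0, norm_mul] at h1
    simp only [add_im, one_im, add_zero, add_re, one_re] at h1
    calc ‖Gamma z‖ * |z.im| ^ (n + 1) = |z.im| * ‖Gamma z‖ * |z.im| ^ n := by ring
      _ ≤ ‖z‖ * ‖Gamma z‖ * |z.im| ^ n := by gcongr; exact abs_im_le_norm z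
      _ ≤ _ := by convert h1 using 2; push_cast; ring

/-- On a vertical strip, the Gamma function decays faster than any power of the imaginary part. -/
lemma exists_norm_Gamma_le (a b : ℝ) {δ : ℝ} (hδ : 0 < δ) (N : ℕ) :
    ∃ C : ℝ, 0 ≤ C ∧ ∀ z : ℂ, z.re ∈ Icc a b → δ ≤ |z.im| → ‖Gamma z‖ ≤ C / |z.im| ^ N := by
  -- Shifting by m moves the strip into the right half-plane. The m surplus powers of |Im z| are at
  -- least δ^m and go into the constant.
  obtain ⟨m, hm⟩ := exists_nat_gt (-a)
  have hcont : ContinuousOn (fun x : ℝ => Real.Gamma (x + (N + m : ℕ))) (Icc a b) := by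
    intro x hx
    refine ((Real.differentiableAt_Gamma fun k => ?_).continuousAt.comp
      (f := fun x : ℝ => x + (N + m : ℕ)) (by fun_prop)).continuousWithinAt
    have h1 : (0 : ℝ) ≤ k := k.cast_nonneg
    have h2 : (0 : ℝ) ≤ N := N.cast_nonneg
    have h3 := hx.1
    push_cast
    linarith
  obtain ⟨M, hM⟩ := isCompact_Icc.exists_bound_of_continuousOn hcont
  refine ⟨|M| / δ ^ m, by positivity, fun z hz him => ?_⟩
  have hpos : 0 < |z.im| := hδ.trans_le him
  have h2 : (0 : ℝ) ≤ N := N.cast_nonneg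
  have h := norm_Gamma_mul_abs_im_pow_le (N + m) (z := z)
    (by push_cast; linarith [hz.1]) (abs_pos.1 hpos)
  have h' : ‖Gamma z‖ * |z.im| ^ (N + m) ≤ |M| :=
    h.trans ((le_abs_self _).trans ((hM _ hz).trans (le_abs_self M)))
  rw [div_div, le_div_iff₀ (by positivity)]
  refine le_trans ?_ h'
  rw [pow_add, mul_comm (δ ^ m)]
  gcongr

end FoxH

/-! ### The integrand of the closed form -/

namespace THz

open FoxH

/-- First components of the lower parameters, with free `K` and `φ`. -/
def shiftedLower (K φ σ : ℝ) : Fin 3 → ℂ := ![0, (K : ℂ), ((-(φ / 2) - σ : ℝ) : ℂ)]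

/-- The integrand of the Fox H function in the closed form, with free `K` and `φ`. -/
def mgfIntegrand (α K φ σ : ℝ) (z : ℂ) : ℂ → ℂ :=
  integrand 3 1 (upperShift φ) (upperScale α) (shiftedLower K φ σ) (lowerScale α) z

lemma mgfIntegrand_apply (α K φ σ : ℝ) (z u : ℂ) :
    mgfIntegrand α K φ σ z u = Gamma u * Gamma (K + u) * Gamma (-(φ / 2) - σ + α / 2 * u) *
      (Gamma (φ / 2 - α / 2 * u) * (Gamma (1 + u))⁻¹) * z ^ (-u) := by
  simp only [mgfIntegrand, integrand, kernel, upperShift, upperScale, shiftedLower, lowerScale,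
    Fin.prod_univ_three, Fin.prod_univ_two]
  simp

lemma lowerScale_pos {α : ℝ} (hα : 0 < α) (j : Fin 3) : 0 < lowerScale α j := by
  fin_cases j <;> simp [lowerScale, hα]

lemma upperScale_pos {α : ℝ} (hα : 0 < α) (j : Fin 2) : 0 < upperScale α j := by
  fin_cases j <;> simp [upperScale, hα]

lemma shiftedLower_im (K φ σ : ℝ) (j : Fin 3) : (shiftedLower K φ σ j).im = 0 := by
  fin_cases j <;> simp [shiftedLower]

lemma upperShift_im (φ : ℝ) (j : Fin 2) : (upperShift φ j).im = 0 := by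
  fin_cases j <;> simp [upperShift]

lemma mem_leftPoles_iff {α K φ σ : ℝ} {w : ℂ} :
    w ∈ leftPoles 3 (shiftedLower K φ σ) (lowerScale α) ↔
      ∃ k : ℕ, w = -k ∨ K + w = -k ∨ -(φ / 2) - σ + α / 2 * w = -k := by
  simp only [leftPoles, mem_ofPred_eq, Fin.exists_fin_succ, shiftedLower, lowerScale]
  simp
  constructor
  · rintro (⟨k, h⟩ | ⟨k, h⟩ | ⟨k, h⟩)
    · exact ⟨k, Or.inl h⟩
    · exact ⟨k, Or.inr (Or.inl h)⟩
    · exact ⟨k, Or.inr (Or.inr h)⟩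
  · rintro ⟨k, h | h | h⟩
    · exact Or.inl ⟨k, h⟩
    · exact Or.inr (Or.inl ⟨k, h⟩)
    · exact Or.inr (Or.inr ⟨k, h⟩)

lemma mem_rightPoles_iff {α φ : ℝ} {w : ℂ} :
    w ∈ rightPoles 1 (upperShift φ) (upperScale α) ↔ ∃ k : ℕ, φ / 2 - α / 2 * w = -k := by
  simp [rightPoles, upperShift, upperScale]

/-- Right poles have real part at least φ/α, while the poles of Γ(u) and Γ(K + u) lie strictly to
the left of φ/α. A pole of the third factor can meet a right pole only if σ = k + l. -/
lemma disjoint_poles {α K φ σ : ℝ} (hα : 0 < α) (hφ : 0 < φ) (hK : 0 < K + φ / α)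
    (hσ : ∀ N : ℕ, σ ≠ N) :
    Disjoint (leftPoles 3 (shiftedLower K φ σ) (lowerScale α))
      (rightPoles 1 (upperShift φ) (upperScale α)) := by
  refine Set.disjoint_left.2 fun w hL hR => ?_
  obtain ⟨k, hL⟩ := mem_leftPoles_iff.1 hL
  obtain ⟨l, hR⟩ := mem_rightPoles_iff.1 hR
  have hR' : φ / 2 - α / 2 * w.re = -l := by simpa using congrArg Complex.re hR
  have hk : (0 : ℝ) ≤ k := k.cast_nonneg
  have hl : (0 : ℝ) ≤ l := l.cast_nonneg
  have hw : φ / α ≤ w.re := by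
    rw [div_le_iff₀ hα]; linarith
  have hφα : 0 < φ / α := by positivity
  rcases hL with h | h | h
  · have : w.re = -k := by simpa using congrArg Complex.re h
    linarith
  · have : K + w.re = -k := by simpa using congrArg Complex.re h
    linarith
  · have : -(φ / 2) - σ + α / 2 * w.re = -k := by simpa using congrArg Complex.re h
    exact hσ (k + l) (by push_cast; linarith)

lemma isMellinBarnes {α K φ σ r : ℝ} (hα : 0 < α) (hφ : 0 < φ) (hK : 0 < K + φ / α)
    (hσ : ∀ N : ℕ, σ ≠ N) (hr : 0 < r) :
    IsMellinBarnes (leftPoles 3 (shiftedLower K φ σ) (lowerScale α))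
      (rightPoles 1 (upperShift φ) (upperScale α)) (mgfIntegrand α K φ σ r) := by
  have hr0 : (r : ℂ) ≠ 0 := ofReal_ne_zero.2 hr.ne'
  refine ⟨disjoint_poles hα hφ hK hσ, ?_, finite_leftPoles_gt (lowerScale_pos hα),
    finite_rightPoles_lt (upperScale_pos hα),
    meromorphicAt_integrand hr0, fun u hu => differentiableAt_integrand hr0 hu, fun a b => ?_⟩
  · rintro w (hw | hw)
    · exact im_eq_zero_of_mem_leftPoles (shiftedLower_im K φ σ) (lowerScale_pos hα) hw
    · exact im_eq_zero_of_mem_rightPoles (upperShift_im φ) (upperScale_pos hα) hw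
  -- For the decay, Γ(φ/2 - αu/2) alone supplies t⁻²; the other two Gamma factors and the power are
  -- merely bounded, and Γ(u)/Γ(1 + u) = 1/u has norm at most 1.
  obtain ⟨C₁, hC₁, h₁⟩ := exists_norm_Gamma_le (K + a) (K + b) one_pos 0
  obtain ⟨C₂, hC₂, h₂⟩ := exists_norm_Gamma_le (-(φ / 2) - σ + α / 2 * a)
    (-(φ / 2) - σ + α / 2 * b) (half_pos hα) 0
  obtain ⟨C₃, hC₃, h₃⟩ := exists_norm_Gamma_le (φ / 2 - α / 2 * b) (φ / 2 - α / 2 * a)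
    (half_pos hα) 2
  obtain ⟨C₄, h₄⟩ := (isCompact_Icc (a := a) (b := b)).exists_bound_of_continuousOn
    (f := fun x : ℝ => r ^ (-x)) (Continuous.continuousOn
      (Continuous.rpow continuous_const continuous_neg fun x => Or.inl hr.ne'))
  refine ⟨C₁ * C₂ * (C₃ / (α / 2) ^ 2) * C₄, fun x hx t ht => ?_⟩
  set u : ℂ := x + t * I with hu
  have hure : u.re = x := by simp [hu]
  have huim : u.im = t := by simp [hu]
  have ht0 : 0 < |t| := one_pos.trans_le ht
  have hu0 : u ≠ 0 := fun h => abs_pos.1 ht0 (by rw [← huim, h, zero_im])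
  have hG : Gamma u ≠ 0 := Gamma_ne_zero fun m h => abs_pos.1 ht0 (by rw [← huim, h]; simp)
  have hx' : α / 2 * a ≤ α / 2 * x ∧ α / 2 * x ≤ α / 2 * b :=
    ⟨by gcongr; exact hx.1, by gcongr; exact hx.2⟩
  have e₁ : ‖Gamma (K + u)‖ ≤ C₁ := by
    simpa using h₁ (K + u) (by simp [hure]; exact hx) (by simpa [huim] using ht)
  have hα' : α / 2 ≤ |α / 2 * t| := by
    rw [abs_mul, abs_of_pos (half_pos hα)]; exact le_mul_of_one_le_right (half_pos hα).le ht
  have hcast : (α / 2 : ℂ) = ((α / 2 : ℝ) : ℂ) := by push_cast; rfl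
  have hcast' : (φ / 2 : ℂ) = ((φ / 2 : ℝ) : ℂ) := by push_cast; rfl
  have e₂ : ‖Gamma (-(φ / 2) - σ + α / 2 * u)‖ ≤ C₂ := by
    have := h₂ (-(φ / 2) - σ + α / 2 * u)
    rw [hcast, hcast'] at this ⊢
    simpa only [pow_zero, div_one] using this (by simp [hure]; exact hx')
      (by simpa [huim] using hα')
  have e₃ : ‖Gamma (φ / 2 - α / 2 * u)‖ ≤ C₃ / (α / 2) ^ 2 / t ^ 2 := by
    have := h₃ (φ / 2 - α / 2 * u)
    rw [hcast, hcast'] at this ⊢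
    have h := this (by simp [hure]; constructor <;> linarith) (by simpa [huim] using hα')
    rw [sq_abs] at h
    refine h.trans_eq ?_
    simp only [sub_im, ofReal_im, im_ofReal_mul, huim]
    rw [div_div]
    congr 1
    ring
  have e₄ : ‖(r : ℂ) ^ (-u)‖ ≤ C₄ := by
    rw [norm_cpow_eq_rpow_re_of_pos hr, neg_re, hure]
    exact (le_abs_self _).trans (h₄ x hx)
  have e₅ : ‖Gamma u * (Gamma (1 + u))⁻¹‖ ≤ 1 := by
    rw [add_comm, Gamma_add_one u hu0, mul_inv, mul_left_comm, mul_inv_cancel₀ hG, mul_one,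
      norm_inv]
    exact inv_le_one_of_one_le₀ (ht.trans (huim ▸ abs_im_le_norm u))
  rw [mgfIntegrand_apply]
  have hC₄ : 0 ≤ C₄ := (norm_nonneg _).trans e₄
  calc _ = ‖Gamma u * (Gamma (1 + u))⁻¹‖ * ‖Gamma (K + u)‖ *
        ‖Gamma (-(φ / 2) - σ + α / 2 * u)‖ * ‖Gamma (φ / 2 - α / 2 * u)‖ * ‖(r : ℂ) ^ (-u)‖ := by
        simp only [norm_mul]; ring
    _ ≤ 1 * C₁ * C₂ * (C₃ / (α / 2) ^ 2 / t ^ 2) * C₄ := by gcongr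
    _ = _ := by ring

end THz

namespace THz

open FoxH

/-! ### Mellin transforms -/

lemma integrableOn_indicator_cpow {s : ℂ} (hs : 0 < s.re) {t : ℝ} (ht : 0 < t) :
    IntegrableOn (fun x : ℝ => (x : ℂ) ^ (s - 1)) (Ioo 0 t) := by
  have := (intervalIntegral.intervalIntegrable_cpow' (a := 0) (b := t) (r := s - 1)
    (by simpa using hs))
  rw [intervalIntegrable_iff_integrableOn_Ioo_of_le ht.le] at this
  exact this

lemma integral_Ioo_cpow {s : ℂ} (hs : 0 < s.re) {t : ℝ} (ht : 0 < t) :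
    ∫ x : ℝ in Ioo 0 t, (x : ℂ) ^ (s - 1) = (t : ℂ) ^ s / s := by
  have hs0 : s ≠ 0 := fun h => by simp [h] at hs
  rw [← integral_Ioc_eq_integral_Ioo, ← intervalIntegral.integral_of_le ht.le,
    integral_cpow (Or.inl (by simpa using hs))]
  simp [zero_cpow hs0]

lemma integral_Ioo_rpow {s : ℝ} (hs : 0 < s) {t : ℝ} (ht : 0 < t) :
    ∫ x : ℝ in Ioo 0 t, x ^ (s - 1) = t ^ s / s := by
  rw [← integral_Ioc_eq_integral_Ioo, ← intervalIntegral.integral_of_le ht.le,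
    integral_rpow (Or.inl (by linarith))]
  simp [Real.zero_rpow hs.ne']

/-- Fubini on the region 0 < x < t: the inner integral of x^(s-1) is t^s / s, and the remaining
t-integral is Γ(K + s). -/
lemma hasMellin_upperGamma {K : ℝ} {s : ℂ} (hs : 0 < s.re) (hK : 0 < K + s.re) :
    HasMellin (fun x => (upperGamma K x : ℂ)) s (Gamma (K + s) / s) := by
  set ν : Measure ℝ := volume.restrict (Ioi 0) with hν
  set Φ : ℝ × ℝ → ℂ := fun z => (if z.1 < z.2 then (z.1 : ℂ) ^ (s - 1) else 0) *
    ((z.2 ^ (K - 1) * Real.exp (-z.2) : ℝ) : ℂ) with hΦ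
  have hmeas : Measurable Φ := by
    refine Measurable.mul (Measurable.ite (measurableSet_lt measurable_fst measurable_snd)
      ?_ measurable_const) ?_
    · exact (measurable_ofReal.comp measurable_fst).pow_const _
    · fun_prop
  have hind : ∀ t : ℝ, (fun x : ℝ => if x < t then (x : ℂ) ^ (s - 1) else 0) =
      (Iio t).indicator fun x : ℝ => (x : ℂ) ^ (s - 1) := fun t => by
    ext x; simp [indicator]
  have hset : ∀ t : ℝ, ν.restrict (Iio t) = volume.restrict (Ioo 0 t) := fun t => by
    rw [hν, Measure.restrict_restrict measurableSet_Iio, Set.inter_comm, Ioi_inter_Iio]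
  have hpos : ∀ᵐ t ∂ν, 0 < t := ae_restrict_mem measurableSet_Ioi
  have hinner : ∀ᵐ t ∂ν, ∫ x, Φ (x, t) ∂ν = (t : ℂ) ^ s / s *
      ((t ^ (K - 1) * Real.exp (-t) : ℝ) : ℂ) := by
    filter_upwards [hpos] with t ht
    simp only [hΦ]
    rw [integral_mul_const, hind, integral_indicator measurableSet_Iio, hset,
      integral_Ioo_cpow hs ht]
  have hnorm : ∀ᵐ t ∂ν, ∫ x, ‖Φ (x, t)‖ ∂ν =
      (s.re)⁻¹ * (Real.exp (-t) * t ^ (K + s.re - 1)) := by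
    filter_upwards [hpos] with t ht
    simp only [hΦ, norm_mul, norm_real, Real.norm_eq_abs]
    have h1 : (fun x : ℝ => ‖if x < t then (x : ℂ) ^ (s - 1) else 0‖) =
      (Iio t).indicator fun x : ℝ => ‖(x : ℂ) ^ (s - 1)‖ := by
      ext x; by_cases hx : x < t <;> simp [indicator, hx]
    rw [integral_mul_const, h1, integral_indicator measurableSet_Iio, hset,
      setIntegral_congr_fun measurableSet_Ioo (g := fun x : ℝ => x ^ (s.re - 1))
        (fun x hx => by simp [norm_cpow_eq_rpow_re_of_pos hx.1]),
      integral_Ioo_rpow hs ht, abs_of_nonneg (by positivity), abs_of_nonneg (Real.exp_pos _).le,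
      show K + s.re - 1 = s.re + (K - 1) by ring, Real.rpow_add ht]
    ring
  have hint : Integrable Φ (ν.prod ν) := by
    rw [integrable_prod_iff' hmeas.aestronglyMeasurable]
    constructor
    · filter_upwards [hpos] with t ht
      simp only [hΦ]
      refine Integrable.mul_const ?_ _
      rw [hind, integrable_indicator_iff measurableSet_Iio, IntegrableOn, hset]
      exact integrableOn_indicator_cpow hs ht
    · exact ((Real.GammaIntegral_convergent hK).const_mul _).congr
        (hnorm.mono fun t ht => ht.symm)
  have hleft : ∀ᵐ x ∂ν, ∫ t, Φ (x, t) ∂ν = (x : ℂ) ^ (s - 1) • (upperGamma K x : ℂ) := by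
    filter_upwards [ae_restrict_mem measurableSet_Ioi] with x hx
    have h1 : (fun t => Φ (x, t)) = (Ioi x).indicator fun t =>
        (x : ℂ) ^ (s - 1) * ((t ^ (K - 1) * Real.exp (-t) : ℝ) : ℂ) := by
      ext t
      by_cases ht : x < t <;> simp [hΦ, indicator, ht]
    rw [h1, integral_indicator measurableSet_Ioi, hν, Measure.restrict_restrict measurableSet_Ioi,
      Ioi_inter_Ioi, sup_eq_left.2 (le_of_lt hx), integral_const_mul, integral_complex_ofReal,
      smul_eq_mul,
      upperGamma]
  constructor
  · exact hint.integral_prod_left.congr hleft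
  · rw [mellin, ← integral_congr_ae hleft, integral_integral_swap (f := fun x t => Φ (x, t)) hint,
      integral_congr_ae hinner, Gamma_eq_integral (by simpa using hK), GammaIntegral,
      ← integral_div]
    refine setIntegral_congr_fun measurableSet_Ioi fun t ht => ?_
    have ht0 : (t : ℂ) ≠ 0 := ofReal_ne_zero.2 (ne_of_gt ht)
    simp only [ofReal_mul, ofReal_cpow (le_of_lt ht), ofReal_sub, ofReal_one]
    rw [show (K : ℂ) + s - 1 = s + (K - 1) by ring, cpow_add _ _ ht0]
    ring

lemma hasMellin_upperGamma_comp {α K C : ℝ} (hα : 0 < α) (hC : 0 < C) {s : ℂ} (hs : 0 < s.re)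
    (hK : 0 < K + s.re / α) :
    HasMellin (fun x => (upperGamma K (C * x ^ α) : ℂ)) s
      ((α : ℂ)⁻¹ * ((C : ℂ) ^ (-(s / α)) * (Gamma (K + s / α) / (s / α)))) := by
  have hre : (s / α).re = s.re / α := div_ofReal_re s α
  have h := hasMellin_upperGamma (K := K) (s := s / α) (by rw [hre]; positivity)
    (by rw [hre]; exact hK)
  constructor
  · exact (MellinConvergent.comp_rpow (f := fun y => (upperGamma K (C * y) : ℂ)) hα.ne').2
      ((MellinConvergent.comp_mul_left (f := fun y => (upperGamma K y : ℂ)) hC).2 h.1)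
  · rw [mellin_comp_rpow (fun y => (upperGamma K (C * y) : ℂ)),
      mellin_comp_mul_left (fun y => (upperGamma K y : ℂ)) _ hC, h.2, abs_of_pos hα, real_smul,
      ofReal_inv, smul_eq_mul]

/-- Interchange of a Mellin transform with an integral along a vertical line. -/
lemma integral_mul_mellin {F : ℝ → ℂ} {s : ℂ} (κ : ℝ) {h : ℝ → ℂ} (hF : MellinConvergent F s)
    (hh : Integrable h) :
    ∫ τ : ℝ, h τ * mellin F (s - κ * τ * I) =
      ∫ x in Ioi (0 : ℝ), (x : ℂ) ^ (s - 1) * F x * ∫ τ : ℝ, h τ * (x : ℂ) ^ (-(κ * τ * I)) := by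
  set ν : Measure ℝ := volume.restrict (Ioi 0) with hν
  set Φ : ℝ × ℝ → ℂ := fun z => cexp (-(κ * z.1 * I) * (Real.log z.2 : ℂ)) *
    (h z.1 * ((z.2 : ℂ) ^ (s - 1) • F z.2)) with hΦ
  have hint : Integrable Φ (volume.prod ν) := by
    -- The oscillating factor x^(-iκτ) has modulus 1, so Φ is dominated by a product of integrable
    -- functions.
    refine (hh.mul_prod hF).bdd_mul (c := 1) ?_ (Eventually.of_forall fun z => ?_)
    · exact Measurable.aestronglyMeasurable (by fun_prop)
    · rw [norm_exp]
      simp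
  have hexp : ∀ (τ x : ℝ), 0 < x → cexp (-(κ * τ * I) * (Real.log x : ℂ)) =
      (x : ℂ) ^ (-(κ * τ * I)) := fun τ x hx => by
    rw [cpow_def_of_ne_zero (ofReal_ne_zero.2 hx.ne'), ofReal_log hx.le, mul_comm]
  calc ∫ τ : ℝ, h τ * mellin F (s - κ * τ * I) = ∫ τ : ℝ, ∫ x, Φ (τ, x) ∂ν := by
        refine integral_congr_ae (Eventually.of_forall fun τ => ?_)
        simp only [mellin, ← integral_const_mul]
        refine setIntegral_congr_fun measurableSet_Ioi fun x hx => ?_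
        have hx0 : (x : ℂ) ≠ 0 := ofReal_ne_zero.2 (ne_of_gt hx)
        simp only [hΦ]
        rw [hexp τ x hx, show s - κ * τ * I - 1 = (s - 1) + -(κ * τ * I) by ring,
          cpow_add _ _ hx0]
        simp only [smul_eq_mul]
        ring
    _ = ∫ x, (∫ τ : ℝ, Φ (τ, x)) ∂ν := integral_integral_swap (f := fun τ x => Φ (τ, x)) hint
    _ = _ := by
        refine setIntegral_congr_fun measurableSet_Ioi fun x hx => ?_
        simp only [← integral_const_mul, hΦ]
        congr 1
        ext τ
        rw [hexp τ x hx]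
        simp only [smul_eq_mul]
        ring

lemma integrable_Gamma_line {v : ℝ} (hv : 0 < v) : Integrable fun τ : ℝ => Gamma (v + τ * I) := by
  obtain ⟨C, -, hC⟩ := exists_norm_Gamma_le v v one_pos 2
  refine integrable_of_norm_le_div_sq (C := C) (continuous_iff_continuousAt.2 fun τ => ?_)
    fun t ht => ?_
  · refine ContinuousAt.comp (f := fun τ : ℝ => (v + τ * I : ℂ))
      (continuousAt_Gamma _ fun m h => ?_) (by fun_prop)
    have := congrArg Complex.re h
    simp at this
    linarith [m.cast_nonneg (α := ℝ)]
  · have := hC (v + t * I) (by simp) (by simpa using ht)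
    simpa using this

/-- The Cahen-Mellin integral. -/
lemma integral_Gamma_mul_cpow {v x : ℝ} (hv : 0 < v) (hx : 0 < x) :
    ∫ τ : ℝ, Gamma (v + τ * I) * (x : ℂ) ^ (-(v + τ * I)) = 2 * Real.pi * Real.exp (-x) := by
  have hm : ∀ s : ℂ, 0 < s.re → mellin (fun x => ((Real.exp (-x) : ℝ) : ℂ)) s = Gamma s :=
    fun s hs => by rw [Gamma_eq_integral hs, GammaIntegral_eq_mellin]
  have hline : (fun y : ℝ => mellin (fun x => ((Real.exp (-x) : ℝ) : ℂ)) (v + y * I)) =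
      fun y : ℝ => Gamma (v + y * I) := by
    ext y; exact hm _ (by simpa using hv)
  have h := mellinInv_mellin_eq v (fun x => ((Real.exp (-x) : ℝ) : ℂ)) hx
    ?_ ?_ (by fun_prop)
  · rw [mellinInv, real_smul] at h
    have hπ : (Real.pi : ℂ) ≠ 0 := ofReal_ne_zero.2 Real.pi_ne_zero
    rw [← h, one_div, ofReal_inv, ofReal_mul, ofReal_ofNat, mul_inv_cancel_left₀ (by simp)]
    congr 1
    ext τ
    rw [congrFun hline τ, smul_eq_mul, mul_comm]
  · have := Complex.GammaIntegral_convergent (s := v) (by simpa using hv)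
    refine this.congr_fun (fun x _ => ?_) measurableSet_Ioi
    simp [mul_comm]
  · rw [VerticalIntegrable, hline]
    exact integrable_Gamma_line hv

lemma integrable_Gamma_mul_Gamma {v b : ℝ} (hv : 0 < v) (hvb : v < b) :
    Integrable fun τ : ℝ => Gamma (v + τ * I) * Gamma (b - v - τ * I) := by
  have h := (integrable_Gamma_line (sub_pos.2 hvb)).comp_neg
  refine (h.bdd_mul (f := fun τ : ℝ => Gamma (v + τ * I)) (c := Real.Gamma v)
    (integrable_Gamma_line hv).aestronglyMeasurable
    (Eventually.of_forall fun τ => ?_)).congr (Eventually.of_forall fun τ => ?_)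
  · simpa using norm_Gamma_le_Gamma_re (z := v + τ * I) (by simp [hv])
  · simp only
    congr 2
    push_cast
    ring

/-- The Mellin-Barnes integral for a negative power of `1 + y`. -/
lemma integral_Gamma_mul_Gamma_mul_cpow {v b y : ℝ} (hv : 0 < v) (hvb : v < b) (hy : 0 < y) :
    ∫ τ : ℝ, Gamma (v + τ * I) * Gamma (b - v - τ * I) * (y : ℂ) ^ (-(v + τ * I)) =
      2 * Real.pi * (Real.Gamma b * (1 + y) ^ (-b) : ℝ) := by
  have hy0 : (y : ℂ) ≠ 0 := ofReal_ne_zero.2 hy.ne'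
  have hyn : ∀ τ : ℝ, ‖(y : ℂ) ^ (-(v + τ * I))‖ = y ^ (-v) := fun τ => by
    rw [norm_cpow_eq_rpow_re_of_pos hy]; simp
  have hh : Integrable fun τ : ℝ => Gamma (v + τ * I) * (y : ℂ) ^ (-(v + τ * I)) := by
    refine (integrable_Gamma_line hv).mul_bdd (c := y ^ (-v)) ?_
      (Eventually.of_forall fun τ => (hyn τ).le)
    exact Continuous.aestronglyMeasurable
      (Continuous.const_cpow (by fun_prop) (Or.inl hy0))
  have hF : MellinConvergent (fun x => ((Real.exp (-x) : ℝ) : ℂ)) (b - v) := by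
    have := Complex.GammaIntegral_convergent (s := b - v) (by simpa using hvb)
    refine this.congr_fun (fun x _ => ?_) measurableSet_Ioi
    simp [mul_comm]
  -- With Γ(b - v - iτ) read as a Mellin transform of exp(-x), the inner line integral becomes a
  -- Cahen-Mellin integral giving exp(-xy). What is left is the Gamma integral of x^(b-1) exp(-(1 +
  -- y)x).
  have h := integral_mul_mellin 1 hF hh
  have hm : ∀ s : ℂ, 0 < s.re → mellin (fun x => ((Real.exp (-x) : ℝ) : ℂ)) s = Gamma s :=
    fun s hs => by rw [Gamma_eq_integral hs, GammaIntegral_eq_mellin]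
  calc _ = _ := by
        refine Eq.trans ?_ h
        congr 1
        ext τ
        rw [hm _ (by simpa using hvb)]
        push_cast
        ring_nf
    _ = ∫ x in Ioi (0 : ℝ), 2 * Real.pi * ((x ^ (b - 1) * Real.exp (-((1 + y) * x)) : ℝ) : ℂ) := by
        refine setIntegral_congr_fun measurableSet_Ioi fun x hx => ?_
        have hx' : 0 < x := hx
        have hx0 : (x : ℂ) ≠ 0 := ofReal_ne_zero.2 (ne_of_gt hx)
        have h1 := integral_Gamma_mul_cpow hv (mul_pos hx' hy)
        have h2 : ∫ τ : ℝ, Gamma (v + τ * I) * (y : ℂ) ^ (-(v + τ * I)) *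
            (x : ℂ) ^ (-((1 : ℝ) * τ * I)) = (x : ℂ) ^ (v : ℂ) *
            ∫ τ : ℝ, Gamma (v + τ * I) * ((x * y : ℝ) : ℂ) ^ (-(v + τ * I)) := by
          rw [← integral_const_mul]
          congr 1
          ext τ
          rw [ofReal_mul, mul_cpow_ofReal_nonneg hx'.le hy.le,
            show (-((1 : ℝ) * τ * I) : ℂ) = v + -(v + τ * I) by push_cast; ring, cpow_add _ _ hx0]
          ring
        simp only [h2, h1]
        have h3 : ((x ^ (b - 1) : ℝ) : ℂ) = (x : ℂ) ^ ((b : ℂ) - v - 1) * (x : ℂ) ^ (v : ℂ) := by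
          rw [← cpow_add _ _ hx0, ofReal_cpow hx'.le]
          congr 1; push_cast; ring
        rw [ofReal_mul, h3, show -((1 + y) * x) = -x + -(x * y) by ring, Real.exp_add, ofReal_mul]
        ring
    _ = _ := by
        rw [integral_const_mul, integral_complex_ofReal,
          Real.integral_rpow_mul_exp_neg_mul_Ioi (hv.trans hvb) (by positivity), one_div,
          Real.inv_rpow (by positivity), ← Real.rpow_neg (by positivity), mul_comm (Real.Gamma b)]

end THz

/-! ### The power moment equals the Mellin-Barnes integral -/

namespace THz

open FoxH

/-- Up to normalization, the expectation of `(1 + c |h|²) ^ σ`. -/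
def powerMoment (α K C c φ σ : ℝ) : ℝ :=
  ∫ x in Ioi (0 : ℝ), (1 + c * x ^ 2) ^ σ * (x ^ (φ - 1) * upperGamma K (C * x ^ α))

variable {α K C c φ σ : ℝ}

lemma integrableOn_rpow_mul_upperGamma (hα : 0 < α) (hC : 0 < C) (hφ : 0 < φ)
    (hK : 0 < K + φ / α) :
    IntegrableOn (fun x : ℝ => x ^ (φ - 1) * upperGamma K (C * x ^ α)) (Ioi 0) := by
  have h := (hasMellin_upperGamma_comp (K := K) (s := φ) hα hC (by simpa using hφ)
    (by simpa using hK)).1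
  refine IntegrableOn.congr_fun (f := fun x : ℝ =>
    ((x : ℂ) ^ ((φ : ℂ) - 1) • (upperGamma K (C * x ^ α) : ℂ)).re) h.re
    (fun x hx => ?_) measurableSet_Ioi
  have h1 : (x : ℂ) ^ ((φ : ℂ) - 1) = ((x ^ (φ - 1) : ℝ) : ℂ) := by
    rw [ofReal_cpow (le_of_lt hx)]; push_cast; rfl
  simp only [h1, smul_eq_mul, ← ofReal_mul, ofReal_re]

/-- Split off one factor 1 + cx²; the x² is absorbed by passing from φ to φ + 2. -/
lemma one_add_mul_sq_rpow_mul (hc : 0 < c) {x : ℝ} (hx : 0 < x) (U : ℝ) :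
    (1 + c * x ^ 2) ^ σ * (x ^ (φ - 1) * U) =
      (1 + c * x ^ 2) ^ (σ - 1) * (x ^ (φ - 1) * U) +
        c * ((1 + c * x ^ 2) ^ (σ - 1) * (x ^ (φ + 2 - 1) * U)) := by
  have h1 : 0 < 1 + c * x ^ 2 := by positivity
  have h2 : (1 + c * x ^ 2) ^ σ = (1 + c * x ^ 2) ^ (σ - 1) * (1 + c * x ^ 2) := by
    rw [← Real.rpow_add_one h1.ne', sub_add_cancel]
  have h3 : x ^ (φ + 2 - 1) = x ^ (φ - 1) * x ^ 2 := by
    rw [← Real.rpow_natCast, ← Real.rpow_add hx]; congr 1; push_cast; ring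
  rw [h2, h3]
  ring

/-- For σ ≤ 0 the power is bounded by 1; the splitting of one factor 1 + cx² carries this up to
every σ. -/
lemma integrableOn_one_add_mul_sq_rpow_mul (hα : 0 < α) (hC : 0 < C) (hc : 0 < c) (hφ : 0 < φ)
    (hK : 0 < K + φ / α) (σ : ℝ) :
    IntegrableOn (fun x : ℝ => (1 + c * x ^ 2) ^ σ * (x ^ (φ - 1) * upperGamma K (C * x ^ α)))
      (Ioi 0) := by
  obtain ⟨n, hn⟩ := exists_nat_ge σ
  induction n generalizing σ φ with
  | zero =>
    refine (integrableOn_rpow_mul_upperGamma hα hC hφ hK).bdd_mul (c := 1) ?_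
      (Eventually.of_forall fun x => ?_)
    · exact Measurable.aestronglyMeasurable (by fun_prop)
    · have h1 : 1 ≤ 1 + c * x ^ 2 := by nlinarith [sq_nonneg x]
      rw [Real.norm_eq_abs, abs_of_nonneg (by positivity)]
      exact Real.rpow_le_one_of_one_le_of_nonpos h1 (by simpa using hn)
  | succ n ih =>
    have hn' : σ - 1 ≤ n := by push_cast at hn; linarith
    have hK' : 0 < K + (φ + 2) / α := hK.trans (by gcongr; linarith)
    refine IntegrableOn.congr_fun ((ih hφ hK (σ - 1) hn').add
      ((ih (φ := φ + 2) (by linarith) hK' (σ - 1) hn').const_mul c)) (fun x hx => ?_)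
      measurableSet_Ioi
    exact (one_add_mul_sq_rpow_mul hc hx _).symm

lemma powerMoment_eq_add (hα : 0 < α) (hC : 0 < C) (hc : 0 < c) (hφ : 0 < φ)
    (hK : 0 < K + φ / α) :
    powerMoment α K C c φ σ =
      powerMoment α K C c φ (σ - 1) + c * powerMoment α K C c (φ + 2) (σ - 1) := by
  have hK' : 0 < K + (φ + 2) / α := hK.trans (by gcongr; linarith)
  unfold powerMoment
  rw [← integral_const_mul, ← integral_add
    (integrableOn_one_add_mul_sq_rpow_mul hα hC hc hφ hK (σ - 1))
    ((integrableOn_one_add_mul_sq_rpow_mul hα hC hc (by linarith) hK' (σ - 1)).const_mul c)]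
  exact setIntegral_congr_fun measurableSet_Ioi fun x hx => one_add_mul_sq_rpow_mul hc hx _

lemma two_pi_mul_powerMoment (hα : 0 < α) (hC : 0 < C) (hc : 0 < c) {b v : ℝ}
    (hv : 0 < v) (hvb : v < b) (hvφ : 0 < φ - 2 * v) (hvK : 0 < K + (φ - 2 * v) / α) :
    2 * Real.pi * (Real.Gamma b * powerMoment α K C c φ (-b) : ℝ) =
      ∫ τ : ℝ, Gamma (v + τ * I) * Gamma (b - v - τ * I) * (c : ℂ) ^ (-(v + τ * I)) *
        ((α : ℂ)⁻¹ * ((C : ℂ) ^ (-((φ - 2 * v - (2 : ℝ) * τ * I) / α)) *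
          (Gamma (K + (φ - 2 * v - (2 : ℝ) * τ * I) / α) /
            ((φ - 2 * v - (2 : ℝ) * τ * I) / α)))) := by
  have hc0 : (c : ℂ) ≠ 0 := ofReal_ne_zero.2 hc.ne'
  have hh : Integrable fun τ : ℝ =>
      Gamma (v + τ * I) * Gamma (b - v - τ * I) * (c : ℂ) ^ (-(v + τ * I)) := by
    refine (integrable_Gamma_mul_Gamma hv hvb).mul_bdd (c := c ^ (-v)) ?_
      (Eventually.of_forall fun τ => ?_)
    · exact Continuous.aestronglyMeasurable (Continuous.const_cpow (by fun_prop) (Or.inl hc0))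
    · rw [norm_cpow_eq_rpow_re_of_pos hc]; simp
  have hM : ∀ τ : ℝ, HasMellin (fun x => (upperGamma K (C * x ^ α) : ℂ))
      (φ - 2 * v - (2 : ℝ) * τ * I) _ := fun τ =>
    hasMellin_upperGamma_comp (K := K) hα hC (by simpa using hvφ) (by simpa using hvK)
  have hM0 := (hM 0).1
  simp only [ofReal_zero, mul_zero, zero_mul, sub_zero] at hM0
  -- The parameter 2 appears because the Mellin-Barnes variable is y = cx², so τ enters through
  -- x^(-2iτ).
  have h := integral_mul_mellin 2 hM0 hh
  simp only [fun τ => (hM τ).2] at h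
  rw [h, powerMoment, ← integral_const_mul, ← integral_complex_ofReal, ← integral_const_mul]
  refine setIntegral_congr_fun measurableSet_Ioi fun x hx => ?_
  have hx' : 0 < x := hx
  have hx0 : (x : ℂ) ≠ 0 := ofReal_ne_zero.2 (ne_of_gt hx)
  have hy : 0 < c * x ^ 2 := by positivity
  have e1 := integral_Gamma_mul_Gamma_mul_cpow hv hvb hy
  have e2 : ∫ τ : ℝ, Gamma (v + τ * I) * Gamma (b - v - τ * I) * (c : ℂ) ^ (-(v + τ * I)) *
      (x : ℂ) ^ (-((2 : ℝ) * τ * I)) = (x : ℂ) ^ (2 * v : ℂ) *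
      ∫ τ : ℝ, Gamma (v + τ * I) * Gamma (b - v - τ * I) *
        ((c * x ^ 2 : ℝ) : ℂ) ^ (-(v + τ * I)) := by
    rw [← integral_const_mul]
    congr 1
    ext τ
    have e3 : ((x ^ 2 : ℝ) : ℂ) ^ (-(v + τ * I)) = (x : ℂ) ^ (2 * -(v + τ * I)) := by
      rw [cpow_def_of_ne_zero hx0,
        cpow_def_of_ne_zero (by rw [ofReal_pow]; exact pow_ne_zero 2 hx0),
        ← ofReal_log (by positivity), Real.log_pow, ← ofReal_log hx'.le]
      congr 1
      push_cast
      ring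
    rw [ofReal_mul, mul_cpow_ofReal_nonneg hc.le (by positivity), e3,
      show (-((2 : ℝ) * τ * I) : ℂ) = 2 * v + 2 * -(v + τ * I) by push_cast; ring,
      cpow_add _ _ hx0]
    ring
  have e4 : ((x ^ (φ - 1) : ℝ) : ℂ) = (x : ℂ) ^ ((φ : ℂ) - 2 * v - 1) * (x : ℂ) ^ (2 * v : ℂ) := by
    rw [← cpow_add _ _ hx0, ofReal_cpow hx'.le]
    congr 1; push_cast; ring
  simp only [e2, e1]
  simp only [ofReal_mul, e4]
  ring

/-- The substitution is v + iτ = φ/2 - αu/2, hence τ = -(α/2)t. The factor 1/u from the Mellin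
transform is rewritten as Γ(u)/Γ(1 + u). -/
lemma mgfIntegrand_eq (hα : 0 < α) (hC : 0 < C) (hc : 0 < c) {b v t : ℝ} (hvφ : 0 < φ - 2 * v) :
    Gamma (v + (-(α / 2) * t : ℝ) * I) * Gamma (b - v - (-(α / 2) * t : ℝ) * I) *
      (c : ℂ) ^ (-(v + (-(α / 2) * t : ℝ) * I)) *
        ((α : ℂ)⁻¹ * ((C : ℂ) ^ (-((φ - 2 * v - (2 : ℝ) * (-(α / 2) * t : ℝ) * I) / α)) *
          (Gamma (K + (φ - 2 * v - (2 : ℝ) * (-(α / 2) * t : ℝ) * I) / α) /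
            ((φ - 2 * v - (2 : ℝ) * (-(α / 2) * t : ℝ) * I) / α)))) =
      ((c ^ (-(φ / 2)) / α : ℝ) : ℂ) * mgfIntegrand α K φ (-b) ((C / c ^ (α / 2) : ℝ) : ℂ)
        (((φ - 2 * v) / α : ℝ) + t * I) := by
  have hα0 : (α : ℂ) ≠ 0 := ofReal_ne_zero.2 hα.ne'
  have hr : 0 < C / c ^ (α / 2) := by positivity
  set u : ℂ := ((φ - 2 * v) / α : ℝ) + t * I with hu
  have hure : 0 < u.re := by simp [hu]; positivity
  have hu0 : u ≠ 0 := fun h => by simp [h] at hure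
  have hG : Gamma u ≠ 0 := Gamma_ne_zero_of_re_pos hure
  have e1 : ((φ : ℂ) - 2 * v - (2 : ℝ) * (-(α / 2) * t : ℝ) * I) / α = u := by
    rw [hu]; push_cast; field_simp; ring
  have e2 : (v : ℂ) + (-(α / 2) * t : ℝ) * I = φ / 2 - α / 2 * u := by
    rw [← e1]; push_cast; field_simp; ring
  have e3 : (b : ℂ) - v - (-(α / 2) * t : ℝ) * I = -(φ / 2) - (-b : ℝ) + α / 2 * u := by
    rw [sub_sub, e2]; push_cast; ring
  have e4 : (c : ℂ) ^ (-(φ / 2 - α / 2 * u)) * (C : ℂ) ^ (-u) =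
      ((c ^ (-(φ / 2)) : ℝ) : ℂ) * ((C / c ^ (α / 2) : ℝ) : ℂ) ^ (-u) := by
    rw [ofReal_cpow hc.le, cpow_def_of_ne_zero (ofReal_ne_zero.2 hc.ne'),
      cpow_def_of_ne_zero (ofReal_ne_zero.2 hC.ne'), cpow_def_of_ne_zero (ofReal_ne_zero.2 hc.ne'),
      cpow_def_of_ne_zero (ofReal_ne_zero.2 hr.ne'), ← exp_add, ← exp_add, ← ofReal_log hr.le,
      Real.log_div hC.ne' (by positivity), Real.log_rpow hc, ← ofReal_log hc.le,
      ← ofReal_log hC.le]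
    congr 1
    push_cast
    ring
  have e5 : Gamma u * (Gamma (1 + u))⁻¹ = u⁻¹ := by
    rw [add_comm, Gamma_add_one u hu0, mul_inv, mul_left_comm, mul_inv_cancel₀ hG, mul_one]
  rw [e1, e2, e3, mgfIntegrand_apply, ofReal_div]
  calc _ = ((c : ℂ) ^ (-(φ / 2 - α / 2 * u)) * (C : ℂ) ^ (-u)) * (α : ℂ)⁻¹ * u⁻¹ *
        (Gamma (φ / 2 - α / 2 * u) * Gamma (-(φ / 2) - (-b : ℝ) + α / 2 * u) * Gamma (K + u)) := by
        ring
    _ = _ := by rw [e4, ← e5]; ring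

lemma _root_.FoxH.contourIntegral_eq_of_eq_empty {PL PR : Set ℂ} {γ ε : ℝ} {f : ℂ → ℂ}
    (hL : {w ∈ PL | γ < w.re} = ∅) (hR : {w ∈ PR | w.re < γ} = ∅) :
    contourIntegral PL PR γ ε f = (2 * Real.pi * I)⁻¹ * ∫ t : ℝ, f (γ + t * I) * I := by
  rw [contourIntegral, hL, hR]
  simp only [finsum_mem_empty, add_zero, sub_zero]

lemma exists_contourIntegral_of_neg (hα : 0 < α) (hC : 0 < C) (hc : 0 < c) (hφ : 0 < φ)
    (hK : 0 < K + φ / α) (hσ : σ < 0) :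
    ∃ γ ε, IsSeparating (leftPoles 3 (shiftedLower K φ σ) (lowerScale α))
        (rightPoles 1 (upperShift φ) (upperScale α)) γ ε ∧
      contourIntegral (leftPoles 3 (shiftedLower K φ σ) (lowerScale α))
        (rightPoles 1 (upperShift φ) (upperScale α)) γ ε
        (mgfIntegrand α K φ σ ((C / c ^ (α / 2) : ℝ) : ℂ)) =
      ((2 * Real.Gamma (-σ) * c ^ (φ / 2) * powerMoment α K C c φ σ : ℝ) : ℂ) := by
  have hK' : 0 < K * α + φ := by
    have := mul_pos hK hα
    rwa [add_mul, div_mul_cancel₀ _ hα.ne'] at this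
  -- The bounds v < -σ, v < φ/2 and v < (Kα + φ)/2 put the line γ = (φ - 2v)/α to the right of the
  -- three left families of poles, and v > 0 puts it to the left of the right poles. The radius ε is
  -- then irrelevant.
  obtain ⟨v, hv, hv'⟩ := exists_between
    (lt_min (neg_pos.2 hσ) (lt_min (half_pos hφ) (half_pos hK')))
  obtain ⟨hvb, hv1, hv2⟩ := by simpa only [lt_min_iff] using hv'
  have hvφ : 0 < φ - 2 * v := by linarith
  have hvK : 0 < K + (φ - 2 * v) / α := by
    rw [← sub_pos, sub_zero, ← mul_pos_iff_of_pos_right hα, add_mul, div_mul_cancel₀ _ hα.ne']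
    linarith
  set γ : ℝ := (φ - 2 * v) / α with hγ
  have hγ0 : 0 < γ := by positivity
  have hγα : α / 2 * γ = φ / 2 - v := by rw [hγ]; field_simp
  have hleft : ∀ w ∈ leftPoles 3 (shiftedLower K φ σ) (lowerScale α), w.re < γ := by
    intro w hw
    obtain ⟨k, h⟩ := mem_leftPoles_iff.1 hw
    have hk : (0 : ℝ) ≤ k := k.cast_nonneg
    rcases h with h | h | h
    · have : w.re = -k := by simpa using congrArg Complex.re h
      linarith
    · have : K + w.re = -k := by simpa using congrArg Complex.re h
      linarith
    · have : -(φ / 2) - σ + α / 2 * w.re = -k := by simpa using congrArg Complex.re h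
      refine lt_of_mul_lt_mul_left (a := α / 2) ?_ (half_pos hα).le
      linarith
  have hright : ∀ w ∈ rightPoles 1 (upperShift φ) (upperScale α), γ < w.re := by
    intro w hw
    obtain ⟨k, h⟩ := mem_rightPoles_iff.1 hw
    have hk : (0 : ℝ) ≤ k := k.cast_nonneg
    have : φ / 2 - α / 2 * w.re = -k := by simpa using congrArg Complex.re h
    refine lt_of_mul_lt_mul_left (a := α / 2) ?_ (half_pos hα).le
    linarith
  have hL0 : {w ∈ leftPoles 3 (shiftedLower K φ σ) (lowerScale α) | γ < w.re} = ∅ :=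
    eq_empty_of_forall_notMem fun w hw => lt_asymm hw.2 (hleft w hw.1)
  have hR0 : {w ∈ rightPoles 1 (upperShift φ) (upperScale α) | w.re < γ} = ∅ :=
    eq_empty_of_forall_notMem fun w hw => lt_asymm hw.2 (hright w hw.1)
  refine ⟨γ, 1, ⟨disjoint_poles hα hφ hK fun N h => ?_, one_pos, ?_, ?_⟩, ?_⟩
  · rw [h] at hσ; exact absurd hσ (not_lt.2 N.cast_nonneg)
  · rintro w (hw | hw)
    · exact (hleft w hw).ne
    · exact (hright w hw).ne'
  · rw [hL0, hR0]; simp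
  have hvalue := contourIntegral_eq_of_eq_empty (f := mgfIntegrand α K φ σ
    ((C / c ^ (α / 2) : ℝ) : ℂ)) (ε := 1) hL0 hR0
  rw [hvalue, integral_mul_const]
  have h := two_pi_mul_powerMoment hα hC hc hv hvb hvφ hvK
  have hcv := Measure.integral_comp_mul_left (fun τ : ℝ =>
    Gamma (v + τ * I) * Gamma ((-σ : ℝ) - v - τ * I) * (c : ℂ) ^ (-(v + τ * I)) *
        ((α : ℂ)⁻¹ * ((C : ℂ) ^ (-((φ - 2 * v - (2 : ℝ) * τ * I) / α)) *
          (Gamma (K + (φ - 2 * v - (2 : ℝ) * τ * I) / α) /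
            ((φ - 2 * v - (2 : ℝ) * τ * I) / α))))) (-(α / 2))
  simp only [mgfIntegrand_eq hα hC hc hvφ, neg_neg] at hcv
  rw [integral_const_mul, ← h, neg_neg, ← hγ, real_smul, inv_neg, abs_neg,
    abs_of_pos (by positivity)] at hcv
  have hcc : ((c ^ (-(φ / 2)) : ℝ) : ℂ) * ((c ^ (φ / 2) : ℝ) : ℂ) = 1 := by
    rw [← ofReal_mul, ← Real.rpow_add hc]; simp
  have hα0 : (α : ℂ) ≠ 0 := ofReal_ne_zero.2 hα.ne'
  have hπ : (Real.pi : ℂ) ≠ 0 := ofReal_ne_zero.2 Real.pi_ne_zero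
  set J := ∫ t : ℝ, mgfIntegrand α K φ σ ((C / c ^ (α / 2) : ℝ) : ℂ) (γ + t * I)
  have hJ : J = 2 * (((c ^ (φ / 2) : ℝ) : ℂ) *
      (2 * Real.pi * (Real.Gamma (-σ) * powerMoment α K C c φ σ : ℝ))) := by
    push_cast at hcv ⊢
    field_simp at hcv
    linear_combination (↑(c ^ (φ / 2)) : ℂ) * hcv - J * hcc
  rw [hJ]
  push_cast
  field_simp

lemma leftPoles_sub_one_subset :
    leftPoles 3 (shiftedLower K φ (σ - 1)) (lowerScale α) ⊆
      leftPoles 3 (shiftedLower K φ σ) (lowerScale α) := by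
  intro w hw
  obtain ⟨k, h | h | h⟩ := mem_leftPoles_iff.1 hw
  · exact mem_leftPoles_iff.2 ⟨k, Or.inl h⟩
  · exact mem_leftPoles_iff.2 ⟨k, Or.inr (Or.inl h)⟩
  · refine mem_leftPoles_iff.2 ⟨k + 1, Or.inr (Or.inr ?_)⟩
    push_cast at h ⊢
    linear_combination h

lemma leftPoles_add_two_sub_one :
    leftPoles 3 (shiftedLower K (φ + 2) (σ - 1)) (lowerScale α) =
      leftPoles 3 (shiftedLower K φ σ) (lowerScale α) := by
  have : shiftedLower K (φ + 2) (σ - 1) = shiftedLower K φ σ := by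
    rw [shiftedLower, shiftedLower]; congr 4; ring_nf
  rw [this]

lemma rightPoles_add_two_subset :
    rightPoles 1 (upperShift (φ + 2)) (upperScale α) ⊆
      rightPoles 1 (upperShift φ) (upperScale α) := by
  intro w hw
  obtain ⟨k, h⟩ := mem_rightPoles_iff.1 hw
  refine mem_rightPoles_iff.2 ⟨k + 1, ?_⟩
  push_cast at h ⊢
  linear_combination h

/-- With A = -φ/2 - σ + αu/2 and B = φ/2 - αu/2 one has A + B = -σ, and Γ(A + 1)Γ(B) + Γ(A)Γ(B + 1)
= (A + B)Γ(A)Γ(B). -/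
lemma neg_mul_mgfIntegrand {z u : ℂ} (hu : u ∉ leftPoles 3 (shiftedLower K φ σ) (lowerScale α) ∪
      rightPoles 1 (upperShift φ) (upperScale α)) :
    -σ * mgfIntegrand α K φ σ z u =
      mgfIntegrand α K φ (σ - 1) z u + mgfIntegrand α K (φ + 2) (σ - 1) z u := by
  have h1 : -(φ / 2) - σ + α / 2 * u ≠ 0 := fun h =>
    hu (Or.inl (mem_leftPoles_iff.2 ⟨0, Or.inr (Or.inr (by simpa using h))⟩))
  have h2 : φ / 2 - α / 2 * u ≠ 0 := fun h =>
    hu (Or.inr (mem_rightPoles_iff.2 ⟨0, by simpa using h⟩))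
  simp only [mgfIntegrand_apply]
  push_cast
  rw [show -((φ : ℂ) / 2) - (σ - 1) + α / 2 * u = -(φ / 2) - σ + α / 2 * u + 1 by ring,
    show -(((φ : ℂ) + 2) / 2) - (σ - 1) + α / 2 * u = -(φ / 2) - σ + α / 2 * u by ring,
    show ((φ : ℂ) + 2) / 2 - α / 2 * u = φ / 2 - α / 2 * u + 1 by ring,
    Gamma_add_one _ h1, Gamma_add_one _ h2]
  ring

/-- The defining Mellin-Barnes integral, for exponents that are not natural numbers. -/
theorem contourIntegral_mgfIntegrand (hα : 0 < α) (hC : 0 < C) (hc : 0 < c) (hφ : 0 < φ)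
    (hK : 0 < K + φ / α) (hσ : ∀ N : ℕ, σ ≠ N) {γ ε : ℝ}
    (hsep : IsSeparating (leftPoles 3 (shiftedLower K φ σ) (lowerScale α))
      (rightPoles 1 (upperShift φ) (upperScale α)) γ ε) :
    contourIntegral (leftPoles 3 (shiftedLower K φ σ) (lowerScale α))
        (rightPoles 1 (upperShift φ) (upperScale α)) γ ε
        (mgfIntegrand α K φ σ ((C / c ^ (α / 2) : ℝ) : ℂ)) =
      ((2 * Real.Gamma (-σ) * c ^ (φ / 2) * powerMoment α K C c φ σ : ℝ) : ℂ) := by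
  have hr : 0 < C / c ^ (α / 2) := by positivity
  obtain ⟨n, hn⟩ := exists_nat_gt σ
  induction n generalizing σ φ γ ε with
  | zero =>
    obtain ⟨γ', ε', hsep', h⟩ := exists_contourIntegral_of_neg hα hC hc hφ hK (by simpa using hn)
    rw [← h]
    exact (isMellinBarnes hα hφ hK hσ hr).contourIntegral_eq hsep subset_rfl subset_rfl hsep'
      subset_rfl subset_rfl
  | succ n ih =>
    have hn' : σ - 1 < n := by push_cast at hn; linarith
    have hσ' : ∀ N : ℕ, σ - 1 ≠ N := fun N h => hσ (N + 1) (by push_cast; linarith)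
    have hK' : 0 < K + (φ + 2) / α := hK.trans (by gcongr; linarith)
    have hφ' : 0 < φ + 2 := by linarith
    have hσ0 : σ ≠ 0 := by simpa using hσ 0
    have hσc : (σ : ℂ) ≠ 0 := ofReal_ne_zero.2 hσ0
    have hF := isMellinBarnes hα hφ hK hσ hr
    have hf := isMellinBarnes hα hφ hK hσ' hr
    have hg := isMellinBarnes hα hφ' hK' hσ' hr
    have hadd := hF.mul_contourIntegral_eq_add hf hg hsep leftPoles_sub_one_subset subset_rfl
      leftPoles_add_two_sub_one.subset rightPoles_add_two_subset
      (fun u hu => neg_mul_mgfIntegrand hu)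
    obtain ⟨γ₁, ε₁, hsep₁⟩ := hf.exists_isSeparating
    obtain ⟨γ₂, ε₂, hsep₂⟩ := hg.exists_isSeparating
    -- The induction hypothesis speaks of contours for the summands' own pole sets, so both
    -- integrals are first moved there.
    rw [hf.contourIntegral_eq hsep leftPoles_sub_one_subset subset_rfl hsep₁ subset_rfl subset_rfl,
      hg.contourIntegral_eq hsep leftPoles_add_two_sub_one.subset rightPoles_add_two_subset hsep₂
        subset_rfl subset_rfl,
      ih hφ hK hσ' hsep₁ hn', ih hφ' hK' hσ' hsep₂ hn'] at hadd
    refine mul_left_cancel₀ (neg_ne_zero.2 hσc) (hadd.trans ?_)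
    have hG : Real.Gamma (-(σ - 1)) = -σ * Real.Gamma (-σ) := by
      rw [← Real.Gamma_add_one (neg_ne_zero.2 hσ0)]; congr 1; ring
    have hcφ : c ^ ((φ + 2) / 2) = c ^ (φ / 2) * c := by
      rw [← Real.rpow_add_one hc.ne']; congr 1; ring
    rw [powerMoment_eq_add (σ := σ) hα hC hc hφ hK, hG, hcφ]
    push_cast
    ring

end THz

/-! ### Back to the channel: law of the envelope and the closed form -/

namespace THz

open FoxH

variable {α μ φ S hf ρ : ℝ} {hl : ℂ}

lemma constK_add (hα : 0 < α) : constK α μ φ + φ / α = μ := by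
  rw [constK]; field_simp; ring

lemma constC_pos (hμ : 0 < μ) (hS : 0 < S) (hhf : 0 < hf) : 0 < constC α μ S hf := by
  unfold constC; positivity

lemma envelopePDF_eq (hα : 0 < α) (hS : 0 < S) (hhf : 0 < hf) (x : ℝ) :
    envelopePDF α μ φ S hf x = constXi α μ φ S hf *
      (x ^ (φ - 1) * upperGamma (constK α μ φ) (constC α μ S hf * x ^ α)) := by
  have h1 : (α * μ - φ) / α = constK α μ φ := by rw [constK]; field_simp
  have h2 : μ * x ^ α / (S ^ α * hf ^ α) = constC α μ S hf * x ^ α := by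
    rw [constC, Real.rpow_neg (by positivity), Real.mul_rpow hS.le hhf.le]; field_simp
  rw [envelopePDF, h1, h2, constXi, Real.rpow_neg hS.le, Real.rpow_neg hhf.le]
  field_simp

lemma upperGamma_nonneg {a x : ℝ} (hx : 0 ≤ x) : 0 ≤ upperGamma a x :=
  setIntegral_nonneg measurableSet_Ioi fun _ ht =>
    mul_nonneg (Real.rpow_nonneg (hx.trans (le_of_lt ht)) _) (Real.exp_pos _).le

lemma envelopePDF_nonneg (hα : 0 < α) (hμ : 0 < μ) (hφ : 0 < φ) (hS : 0 < S) (hhf : 0 < hf)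
    {x : ℝ} (hx : 0 < x) : 0 ≤ envelopePDF α μ φ S hf x := by
  have h1 : 0 ≤ constXi α μ φ S hf := by
    have := Real.Gamma_pos_of_pos hμ
    unfold constXi; positivity
  have h2 : 0 ≤ upperGamma (constK α μ φ) (constC α μ S hf * x ^ α) :=
    upperGamma_nonneg (mul_nonneg (constC_pos hμ hS hhf).le (by positivity))
  rw [envelopePDF_eq hα hS hhf]
  positivity

lemma exp_mul_mutualInfo (hρ : 0 < ρ) {Ω : Type*} (hpf : Ω → ℂ) (s : ℝ) (ω : Ω) :
    Real.exp (s * mutualInfo ρ hl hpf ω) =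
      (1 + ρ * ‖hl‖ ^ 2 * ‖hpf ω‖ ^ 2) ^ (s / Real.log 2) := by
  rw [Real.rpow_def_of_pos (by positivity), mutualInfo, Real.logb]
  congr 1
  ring

/-- Integrals against the law of the envelope. -/
lemma map_norm_integral {Ω : Type*} [MeasurableSpace Ω] {P : Measure Ω} {hpf : Ω → ℂ}
    (hα : 0 < α) (hμ : 0 < μ) (hφ : 0 < φ) (hS : 0 < S) (hhf : 0 < hf)
    (hmeas : AEMeasurable hpf P)
    (hpdf : P.map (fun ω => ‖hpf ω‖) = (volume.restrict (Ioi (0 : ℝ))).withDensity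
      (fun x => ENNReal.ofReal (envelopePDF α μ φ S hf x)))
    {g : ℝ → ℝ} (hg : Measurable g) :
    (IntegrableOn (fun x => g x * (x ^ (φ - 1) *
        upperGamma (constK α μ φ) (constC α μ S hf * x ^ α))) (Ioi 0) →
      Integrable (fun ω => g ‖hpf ω‖) P) ∧
    ∫ ω, g ‖hpf ω‖ ∂P = constXi α μ φ S hf * ∫ x in Ioi (0 : ℝ), g x * (x ^ (φ - 1) *
        upperGamma (constK α μ φ) (constC α μ S hf * x ^ α)) := by
  have hdens : AEMeasurable (fun x => ENNReal.ofReal (envelopePDF α μ φ S hf x))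
      (volume.restrict (Ioi (0 : ℝ))) := by
    simp only [envelopePDF_eq hα hS hhf]
    -- Measurability of the density is read off from the integrability already obtained from the
    -- Mellin transform.
    exact ((integrableOn_rpow_mul_upperGamma hα (constC_pos hμ hS hhf) hφ
      (by rw [constK_add hα]; exact hμ)).aestronglyMeasurable.aemeasurable.const_mul _).ennreal_ofReal
  have hfin : ∀ᵐ x ∂(volume.restrict (Ioi (0 : ℝ))),
      ENNReal.ofReal (envelopePDF α μ φ S hf x) < ⊤ :=
    Eventually.of_forall fun x => ENNReal.ofReal_lt_top
  have hsmul : ∀ x ∈ Ioi (0 : ℝ), (ENNReal.ofReal (envelopePDF α μ φ S hf x)).toReal • g x =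
      constXi α μ φ S hf * (g x * (x ^ (φ - 1) *
        upperGamma (constK α μ φ) (constC α μ S hf * x ^ α))) := fun x hx => by
    rw [ENNReal.toReal_ofReal (envelopePDF_nonneg hα hμ hφ hS hhf hx), envelopePDF_eq hα hS hhf,
      smul_eq_mul]
    ring
  constructor
  · intro hint
    have h : Integrable g (P.map fun ω => ‖hpf ω‖) := by
      rw [hpdf, integrable_withDensity_iff_integrable_smul₀' hdens hfin]
      exact IntegrableOn.congr_fun (hint.const_mul _) (fun x hx => (hsmul x hx).symm)
        measurableSet_Ioi
    exact h.comp_aemeasurable hmeas.norm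
  · rw [← integral_map (f := g) hmeas.norm hg.aestronglyMeasurable, hpdf,
      integral_withDensity_eq_integral_toReal_smul₀ hdens hfin, ← integral_const_mul]
    exact setIntegral_congr_fun measurableSet_Ioi hsmul

lemma foxArg_eq (hρ : 0 < ρ) : foxArg α μ S hf ρ hl =
    ((constC α μ S hf / (ρ * ‖hl‖ ^ 2) ^ (α / 2) : ℝ) : ℂ) := by
  have h : (ρ * ‖hl‖ ^ 2) ^ (α / 2) = ρ ^ (α / 2) * ‖hl‖ ^ α := by
    rw [Real.mul_rpow hρ.le (by positivity), ← Real.rpow_natCast_mul (norm_nonneg hl)]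
    congr 2; push_cast; ring
  rw [foxArg, h]

/-- Every admissible contour gives this number, so the arbitrary choice in `foxH` is harmless. -/
lemma isValue_eq (hα : 0 < α) (hμ : 0 < μ) (hφ : 0 < φ) (hS : 0 < S) (hhf : 0 < hf) (hρ : 0 < ρ)
    (hhl : hl ≠ 0) {s : ℝ} (hs : ∀ N : ℕ, s / Real.log 2 ≠ N) {v : ℂ}
    (hv : IsValue 3 1 (upperShift φ) (upperScale α) (lowerShift α μ φ s) (lowerScale α)
      (foxArg α μ S hf ρ hl) v) :
    v = ((2 * Real.Gamma (-(s / Real.log 2)) * (ρ * ‖hl‖ ^ 2) ^ (φ / 2) *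
      powerMoment α (constK α μ φ) (constC α μ S hf) (ρ * ‖hl‖ ^ 2) φ (s / Real.log 2) : ℝ) : ℂ) := by
  obtain ⟨-, -, -, γ, ε, hsep, -, rfl⟩ := hv
  rw [foxArg_eq hρ]
  exact contourIntegral_mgfIntegrand hα (constC_pos hμ hS hhf)
    (mul_pos hρ (pow_pos (norm_pos_iff.2 hhl) 2)) hφ (by rw [constK_add hα]; exact hμ) hs hsep

lemma exists_isValue (hα : 0 < α) (hμ : 0 < μ) (hφ : 0 < φ) (hS : 0 < S) (hhf : 0 < hf)
    (hρ : 0 < ρ) (hhl : hl ≠ 0) {s : ℝ} (hs : ∀ N : ℕ, s / Real.log 2 ≠ N) :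
    ∃ v, IsValue 3 1 (upperShift φ) (upperScale α) (lowerShift α μ φ s) (lowerScale α)
      (foxArg α μ S hf ρ hl) v := by
  have hr : 0 < constC α μ S hf / (ρ ^ (α / 2) * ‖hl‖ ^ α) := by
    have := constC_pos (α := α) hμ hS hhf
    have := norm_pos_iff.2 hhl
    positivity
  have hMB := isMellinBarnes hα hφ (by rw [constK_add (μ := μ) hα]; exact hμ) hs hr
  obtain ⟨γ, ε, hsep⟩ := hMB.exists_isSeparating
  exact ⟨_, upperScale_pos hα, lowerScale_pos hα, ofReal_ne_zero.2 hr.ne', γ, ε, hsep,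
    hMB.integrable_line hsep.2.2.1, rfl⟩

lemma closedForm_eq (hα : 0 < α) (hμ : 0 < μ) (hφ : 0 < φ) (hS : 0 < S) (hhf : 0 < hf)
    (hρ : 0 < ρ) (hhl : hl ≠ 0) {s : ℝ} (hs : ∀ N : ℕ, s / Real.log 2 ≠ N) :
    closedForm α μ φ S hf ρ hl s = ((constXi α μ φ S hf *
      powerMoment α (constK α μ φ) (constC α μ S hf) (ρ * ‖hl‖ ^ 2) φ (s / Real.log 2) : ℝ) : ℂ) := by
  have hex := exists_isValue (α := α) (μ := μ) hα hμ hφ hS hhf hρ hhl hs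
  have hl0 := norm_pos_iff.2 hhl
  have hG : Real.Gamma (-(s / Real.log 2)) ≠ 0 :=
    Real.Gamma_ne_zero fun m h => hs m (neg_injective h)
  have hc : (ρ * ‖hl‖ ^ 2) ^ (φ / 2) = ρ ^ (φ / 2) * ‖hl‖ ^ φ := by
    rw [Real.mul_rpow hρ.le (by positivity), ← Real.rpow_natCast_mul (norm_nonneg hl)]
    congr 2; push_cast; ring
  rw [closedForm, foxH, dif_pos hex, isValue_eq hα hμ hφ hS hhf hρ hhl hs hex.choose_spec, hc,
    ← ofReal_mul, neg_div, Real.rpow_neg hρ.le, Real.rpow_neg hl0.le]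
  congr 1
  field_simp

end THz

end

/-! ### The moment generating function at regular and exceptional s -/

theorem mainTheorem2
    {Ω : Type*} [MeasurableSpace Ω] (P : MeasureTheory.Measure Ω)
    [MeasureTheory.IsProbabilityMeasure P]
    (α μ φ S hf ρ : ℝ) (hl : ℂ) (hpf : Ω → ℂ)
    (hα : 0 < α) (hμ : 0 < μ) (hφ : 0 < φ) (hS : 0 < S) (hhf : 0 < hf) (hρ : 0 < ρ) (hhl : hl ≠ 0)
    (hmeas : AEMeasurable hpf P)
    (hpdf : P.map (fun ω => ‖hpf ω‖) =
      (MeasureTheory.volume.restrict (Set.Ioi (0 : ℝ))).withDensity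
        (fun x => ENNReal.ofReal (THz.envelopePDF α μ φ S hf x)))
    (s : ℝ) :
    MeasureTheory.Integrable (fun ω => Real.exp (s * THz.mutualInfo ρ hl hpf ω)) P ∧
    ((∀ N : ℕ, s / Real.log 2 ≠ N) →
      (∃ v : ℂ, FoxH.IsValue 3 1 (THz.upperShift φ) (THz.upperScale α)
        (THz.lowerShift α μ φ s) (THz.lowerScale α) (THz.foxArg α μ S hf ρ hl) v) ∧
      ((ProbabilityTheory.mgf (THz.mutualInfo ρ hl hpf) P s : ℝ) : ℂ) =
        THz.closedForm α μ φ S hf ρ hl s) ∧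
    ((∃ N : ℕ, s / Real.log 2 = N) →
      Filter.Tendsto (fun s' : ℝ => THz.closedForm α μ φ S hf ρ hl s') (nhdsWithin s {s}ᶜ)
        (nhds ((ProbabilityTheory.mgf (THz.mutualInfo ρ hl hpf) P s : ℝ) : ℂ))) := by

  have hc : 0 < ρ * ‖hl‖ ^ 2 := mul_pos hρ (pow_pos (norm_pos_iff.2 hhl) 2)
  have hlaw := fun s : ℝ => THz.map_norm_integral hα hμ hφ hS hhf hmeas hpdf
    (g := fun x => (1 + ρ * ‖hl‖ ^ 2 * x ^ 2) ^ (s / Real.log 2)) (by fun_prop)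
  have hint : ∀ s : ℝ,
      MeasureTheory.Integrable (fun ω => Real.exp (s * THz.mutualInfo ρ hl hpf ω)) P := fun s => by
    simp only [THz.exp_mul_mutualInfo hρ]
    exact (hlaw s).1 (THz.integrableOn_one_add_mul_sq_rpow_mul hα (THz.constC_pos hμ hS hhf) hc hφ
      (by rw [THz.constK_add hα]; exact hμ) _)
  have hmgf : ∀ s : ℝ, (∀ N : ℕ, s / Real.log 2 ≠ N) →
      ((ProbabilityTheory.mgf (THz.mutualInfo ρ hl hpf) P s : ℝ) : ℂ) =
        THz.closedForm α μ φ S hf ρ hl s := fun s hs => by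
    rw [THz.closedForm_eq hα hμ hφ hS hhf hρ hhl hs, ProbabilityTheory.mgf]
    simp only [THz.exp_mul_mutualInfo hρ]
    rw [(hlaw s).2, THz.powerMoment]
  refine ⟨hint s, fun hs => ⟨THz.exists_isValue hα hμ hφ hS hhf hρ hhl hs, hmgf s hs⟩, ?_⟩
  rintro ⟨N, hN⟩
  -- The moment generating function is finite everywhere, hence continuous, so it suffices that the
  -- closed form agrees with it near s.
  have hcont : Filter.Tendsto
      (fun s' : ℝ => ((ProbabilityTheory.mgf (THz.mutualInfo ρ hl hpf) P s' : ℝ) : ℂ))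
      (nhdsWithin s {s}ᶜ) (nhds ((ProbabilityTheory.mgf (THz.mutualInfo ρ hl hpf) P s : ℝ) : ℂ)) :=
    ((Complex.continuous_ofReal.comp (ProbabilityTheory.continuous_mgf hint)).tendsto s).mono_left
      nhdsWithin_le_nhds
  refine hcont.congr' ?_
  -- Exceptional points are spaced by ln 2, so the punctured ball of that radius around s contains
  -- none.
  have hlog : 0 < Real.log 2 := Real.log_pos one_lt_two
  filter_upwards [self_mem_nhdsWithin,
    mem_nhdsWithin_of_mem_nhds (Metric.ball_mem_nhds s hlog)] with s' hne hball
  refine hmgf s' fun M hM => hne ?_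
  rw [Metric.mem_ball, Real.dist_eq] at hball
  rw [div_eq_iff hlog.ne'] at hN hM
  rw [hN, hM, ← sub_mul, abs_mul, abs_of_pos hlog] at hball
  have h1 : |(M : ℝ) - N| < 1 := by
    by_contra! h
    exact absurd hball (not_lt.2 (le_mul_of_one_le_left hlog.le h))
  have h2 : (M : ℤ) - N = 0 := Int.abs_lt_one_iff.1 (by exact_mod_cast h1)
  have h3 : M = N := by omega
  rw [Set.mem_singleton_iff, hN, hM, h3]
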